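/- Let $\widehat G$ be a finite group and $G\le\widehat G$ a subgroup of index $2$ (a Real structure on $G$). The type ($\mathbb R$, $\mathbb C$ or $\mathbb H$) of a complex irreducible character $\chi$ of a finite group $H$ is the endomorphism algebra of the corresponding simple $\mathbb RH$-module, i.e. of the simple $\mathbb RH$-module $W$ such that $\chi$ is a constituent of $\mathbb C\otimes_{\mathbb R}W$. Let $\mathbb C*\widehat G$ be the twisted group algebra, with basis $\widehat G$ over $\mathbb C$, in which elements of $G$ commute with scalars and $g\lambda=\overline{\lambda}\,g$ for $\lambda\in\mathbb C$, $g\in\widehat G\setminus G$; its modules are complex vector spaces on which $\widehat G$ acts so that $G$ acts linearly and $\widehat G\setminus G$ antilinearly. For $\chi\in\mathrm{Irr}(G)$ let $\mathbb F_a(\chi)\in\{\mathbb R,\mathbb C,\mathbb H\}$ be the type of $\chi$, and let $\mathbb F_d(\chi)\in\{\mathbb R,\mathbb C,\mathbb H\}$ be the endomorphism algebra of the simple $\mathbb C*\widehat G$-module whose restriction to $G$ has $\chi$ as a constituent. Let $c(\chi)$ be the number of distinct characters among $\chi,\overline\chi,\chi^x,\overline{\chi}^x$, where $x\in\widehat G\setminus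 G$ and $\chi^x(g)=\chi(xgx^{-1})$. The ten Dyson types of $\chi$ are determined by the pair $(\mathbb F_a(\chi),\mathbb F_d(\chi))$ as follows: $$\begin{array}{lll} \text{I}:(\mathbb R,\mathbb R), & \text{II}:(\mathbb R,\mathbb H), & \text{III}:(\mathbb R,\mathbb C),\\ \text{IV}:(\mathbb C,\mathbb C)\text{ with } c(\chi)=2, & \text{V}:(\mathbb C,\mathbb R), & \text{VI}:(\mathbb C,\mathbb H),\\ \text{VII}:(\mathbb C,\mathbb C)\text{ with } c(\chi)=4, & \text{VIII}:(\mathbb H,\mathbb H), & \text{IX}:(\mathbb H,\mathbb R),\\ \text{X}:(\mathbb H,\mathbb C). & & \end{array}$$ Let $N_{I},\dots,N_{X}$ be the numbers of irreducible characters of $G$ of each of these types, and let $\widehat N_{\mathbb R},\widehat N_{\mathbb C},\widehat N_{\mathbb H}$ be the numbers of irreducible characters of $\widehat G$ of type $\mathbb R$, $\mathbb C$, $\mathbb H$, respectively. Then $$2N_{I}+\tfrac12N_{III}+\tfrac12N_{V}=\widehat N_{\mathbb R},$$ $$2N_{II}+2N_{IV}+\tfrac12N_{VII}+2N_{IX}=\widehat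 N_{\mathbb C},$$ $$\tfrac12N_{VI}+2N_{VIII}+\tfrac12N_{X}=\widehat N_{\mathbb H}.$$ -/

import Mathlib

open scoped Quaternion ComplexConjugate

/-- The three finite-dimensional real division algebras `ℝ`, `ℂ`, `ℍ`. -/
inductive DivType
  | real
  | complex
  | quaternion

/-- The real algebra `A` is isomorphic to `ℝ`, `ℂ` or `ℍ`, respectively. -/
def IsOfDivType (A : Type*) [Semiring A] [Algebra ℝ A] : DivType → Prop
  | .real => Nonempty (A ≃ₐ[ℝ] ℝ)
  | .complex => Nonempty (A ≃ₐ[ℝ] ℂ)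
  | .quaternion => Nonempty (A ≃ₐ[ℝ] ℍ[ℝ])

/-- `χ` is the character of the irreducible complex representation `ρ` on `V`. -/
def Affords {H : Type*} [Group H] {V : Type*} [AddCommGroup V] [Module ℂ V]
    (ρ : Representation ℂ H V) (χ : H → ℂ) : Prop :=
  FiniteDimensional ℂ V ∧ ρ.IsIrreducible ∧ ρ.character = χ

/-- `χ` is an irreducible complex character of `H` and the corresponding simple `ℝH`-module `W`
has endomorphism algebra `F`. Here `W` corresponds to `χ`, afforded by `V`, when `V` is a
constituent of `ℂ ⊗ W`, that is, when there is a nonzero `ℝH`-linear map from `W` to `V`. -/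
def HasCharType {H : Type*} [Group H] (χ : H → ℂ) (F : DivType) : Prop :=
  ∃ (V : Type) (_ : AddCommGroup V) (_ : Module ℂ V) (ρ : Representation ℂ H V),
    Affords ρ χ ∧
    ∃ (W : Type) (_ : AddCommGroup W) (_ : Module ℝ W) (σ : Representation ℝ H W),
      σ.IsIrreducible ∧
      (∃ f : W →ₗ[ℝ] V, f ≠ 0 ∧ ∀ (h : H) (w : W), f (σ h w) = ρ h (f w)) ∧
      IsOfDivType (σ.IntertwiningMap σ) F

/-- The number of irreducible complex characters of `H` of type `F`. -/
noncomputable def charCount (H : Type*) [Group H] (F : DivType) : ℕ :=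
  {χ : H → ℂ | HasCharType χ F}.ncard

/-- A Real representation of `G ≤ Γ`, that is, a module over the twisted group algebra `ℂ * Γ`:
a complex vector space with a real-linear action of `Γ` in which the elements of `G` act
linearly and the elements outside `G` act antilinearly. -/
structure AntilinearRep {Γ : Type*} [Group Γ] (G : Subgroup Γ)
    (U : Type*) [AddCommGroup U] [Module ℂ U] where
  act : Representation ℝ Γ U
  act_smul_of_mem : ∀ g ∈ G, ∀ (c : ℂ) (u : U), act g (c • u) = c • act g u
  act_smul_of_notMem : ∀ g ∉ G, ∀ (c : ℂ) (u : U), act g (c • u) = conj c • act g u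

namespace AntilinearRep

/-- Simplicity as a `ℂ * Γ`-module. -/
def IsIrreducible {Γ : Type*} [Group Γ] {G : Subgroup Γ} {U : Type*} [AddCommGroup U] [Module ℂ U]
    (τ : AntilinearRep G U) : Prop :=
  Nontrivial U ∧ ∀ S : Submodule ℂ U, (∀ (g : Γ), ∀ u ∈ S, τ.act g u ∈ S) → S = ⊥ ∨ S = ⊤

/-- The real algebra of `ℂ * Γ`-module endomorphisms: the complex-linear maps commuting with the
action of `Γ`. -/
def endAlg {Γ : Type*} [Group Γ] {G : Subgroup Γ} {U : Type*} [AddCommGroup U] [Module ℂ U]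
    (τ : AntilinearRep G U) : Subalgebra ℝ (Module.End ℂ U) where
  carrier := {f | ∀ (g : Γ) (u : U), f (τ.act g u) = τ.act g (f u)}
  mul_mem' := by
    intro a b ha hb g u
    simp only [Set.mem_ofPred_eq] at ha hb
    simp [Module.End.mul_apply, ha, hb]
  add_mem' := by
    intro a b ha hb g u
    simp only [Set.mem_ofPred_eq] at ha hb
    simp [ha, hb]
  algebraMap_mem' := by
    intro r g u
    simp [Module.algebraMap_end_apply]

end AntilinearRep

/-- `χ` is an irreducible complex character of `G` and the corresponding simple `ℂ * Γ`-module `U`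
has endomorphism algebra `F`. Here `U` corresponds to `χ`, afforded by `V`, when `V` is a
constituent of the restriction of `U` to `G`. -/
def HasRealType {Γ : Type*} [Group Γ] (G : Subgroup Γ) (χ : G → ℂ) (F : DivType) : Prop :=
  ∃ (V : Type) (_ : AddCommGroup V) (_ : Module ℂ V) (ρ : Representation ℂ G V),
    Affords ρ χ ∧
    ∃ (U : Type) (_ : AddCommGroup U) (_ : Module ℂ U) (τ : AntilinearRep G U),
      τ.IsIrreducible ∧
      (∃ f : V →ₗ[ℂ] U, f ≠ 0 ∧ ∀ (g : G) (v : V), f (ρ g v) = τ.act (g : Γ) (f v)) ∧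
      IsOfDivType τ.endAlg F

/-- The conjugate `χ^x : g ↦ χ (x g x⁻¹)`. -/
def conjChar {Γ : Type*} [Group Γ] {G : Subgroup Γ} (hG : G.index = 2) (x : Γ) (χ : G → ℂ) :
    G → ℂ :=
  fun g => χ ⟨x * g * x⁻¹, (Subgroup.normal_of_index_eq_two hG).conj_mem g g.2 x⟩

/-- The orbit `{χ, χ̄, χ^x, χ̄^x}`, with `x ∉ G`, of `χ` under the Klein four-group. -/
def kleinOrbit {Γ : Type*} [Group Γ] {G : Subgroup Γ} (hG : G.index = 2) (χ : G → ℂ) :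
    Set (G → ℂ) :=
  {φ | φ = χ ∨ φ = (fun g => conj (χ g)) ∨
    ∃ x ∉ G, φ = conjChar hG x χ ∨ φ = fun g => conj (conjChar hG x χ g)}

/-- Dyson's ten types. -/
inductive DysonType
  | I
  | II
  | III
  | IV
  | V
  | VI
  | VII
  | VIII
  | IX
  | X

namespace DysonType

/-- The endomorphism algebra of the simple `ℝG`-module (second letter of the Dyson label). -/
def divA : DysonType → DivType
  | I | II | III => .real
  | IV | V | VI | VII => .complex
  | VIII | IX | X => .quaternion

/-- The endomorphism algebra of the simple `ℂ * Γ`-module (first letter of the Dyson label). -/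
def divD : DysonType → DivType
  | I | V | IX => .real
  | III | IV | VII | X => .complex
  | II | VI | VIII => .quaternion

end DysonType

/-- `χ` is an irreducible character of `G` of the given type. The type is determined by the two
endomorphism algebras, except that IV and VII (Dyson's `CC2` and `CC1`) share both; they are told
apart by the number of simple `ℂG`-modules in the antilinear block, i.e. by the size of the orbit
of `χ`, which is 2 for type IV and 4 for type VII. -/
def HasDysonType {Γ : Type*} [Group Γ] {G : Subgroup Γ} (hG : G.index = 2) (χ : G → ℂ)
    (t : DysonType) : Prop :=
  HasCharType χ t.divA ∧ HasRealType G χ t.divD ∧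
    (t = .IV → (kleinOrbit hG χ).ncard = 2) ∧ (t = .VII → (kleinOrbit hG χ).ncard = 4)

/-- The number of irreducible characters of `G` of Dyson type `t`. -/
noncomputable def dysonCount {Γ : Type*} [Group Γ] {G : Subgroup Γ} (hG : G.index = 2)
    (t : DysonType) : ℕ :=
  {χ : G → ℂ | HasDysonType hG χ t}.ncard

/-! Everything is read off from one twisted Frobenius-Schur indicator, `twistedIndicator α b χ`, the
average of `χ (α g * b * g)`. For `α = id`, `b = 1` it is the classical indicator. For `α`
conjugation by `x ∉ G` and `b = x ^ 2` it averages `χ` over the squares of the elements of the coset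
`xG`, since `(x * g) ^ 2 = (x * g * x⁻¹) * x ^ 2 * g`.

Let `χ` be afforded by `ρ`. Antilinear maps `K` with `K (ρ g v) = ρ (α g) (K v)` either all vanish,
or one of them satisfies `K ^ 2 = ρ b`, or one satisfies `K ^ 2 = -ρ b` (`twisted_trichotomy`).
Schur orthogonality gives the indicator the value `0`, `1`, `-1` in these cases
(`twistedIndicator_eq_zero`, `twistedIndicator_eq`). The same `K` controls the endomorphism algebras
of both the simple real module and the simple Real module, so their types ℝ, ℂ, ℍ correspond to
indicators `1`, `0`, `-1` (`hasCharType_iff`, `hasRealType_iff`). Write `a` and `d` for the two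
indicators of `χ`.

Splitting a sum over `Γ` into `G` and `xG` shows that the classical indicator of `ψ` on `Γ` is half
the sum of the two indicators of its restriction. By Clifford theory in index two, `ψ` either
extends an `x`-invariant `χ`, which has exactly two extensions, with indicator `(a + d) / 2`; or it
is induced from exactly two characters `χ ≠ χ^x`, with indicator `a + d`. This yields the weights
`2` and `1 / 2` in `charCount_eq`.

Finally `a ≠ 0` means that the complex conjugate of `χ` is `χ`, and `d ≠ 0` that it is `χ^x`. Hence
types I, II, IV, VIII, IX are the invariant ones and III, V, VI, VII, X the others; sorting them by
`a + d` gives the three identities. -/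

/-! ### Recognising ℝ, ℂ and ℍ among real algebras -/

section Algebras

/-- A nontrivial real algebra all of whose elements are scalars is `ℝ`. -/
theorem isOfDivType_real {A : Type*} [Semiring A] [Algebra ℝ A] [Nontrivial A]
    (h : ∀ a : A, ∃ p : ℝ, a = p • (1 : A)) : IsOfDivType A .real := by
  refine ⟨(AlgEquiv.ofBijective (Algebra.ofId ℝ A) ⟨(Algebra.ofId ℝ A).toRingHom.injective, ?_⟩).symm⟩
  intro a
  obtain ⟨p, rfl⟩ := h a
  exact ⟨p, by simp [Algebra.ofId_apply, Algebra.algebraMap_eq_smul_one]⟩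

/-- A square root of `-1` defines a ring map from ℂ, injective because ℂ is a field and `A` is
nontrivial; the spanning hypothesis is its surjectivity. The quaternionic criterion below works in
the same way. -/
theorem isOfDivType_complex {A : Type*} [Semiring A] [Algebra ℝ A] [Nontrivial A] (i : A)
    (hi : i * i = (-1 : ℝ) • (1 : A))
    (h : ∀ a : A, ∃ p q : ℝ, a = p • (1 : A) + q • i) : IsOfDivType A .complex := by
  let _ : Ring A := Algebra.semiringToRing ℝ
  have hi' : i * i = -1 := by rw [hi, neg_smul, one_smul]
  let φ : ℂ →ₐ[ℝ] A := Complex.liftAux i hi'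
  refine ⟨(AlgEquiv.ofBijective φ ⟨φ.toRingHom.injective, ?_⟩).symm⟩
  intro a
  obtain ⟨p, q, rfl⟩ := h a
  exact ⟨⟨p, q⟩, by simp [φ, Complex.liftAux_apply, Algebra.algebraMap_eq_smul_one]⟩

theorem isOfDivType_quaternion {A : Type*} [Semiring A] [Algebra ℝ A] [Nontrivial A] (i j : A)
    (hi : i * i = (-1 : ℝ) • (1 : A)) (hj : j * j = (-1 : ℝ) • (1 : A))
    (hij : j * i = (-1 : ℝ) • (i * j))
    (h : ∀ a : A, ∃ p q r s : ℝ, a = p • (1 : A) + q • i + r • j + s • (i * j)) :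
    IsOfDivType A .quaternion := by
  let _ : Ring A := Algebra.semiringToRing ℝ
  let B : QuaternionAlgebra.Basis A (-1 : ℝ) 0 (-1) :=
    { i := i, j := j, k := i * j
      i_mul_i := by simp [hi]
      j_mul_j := by simp [hj]
      i_mul_j := rfl
      j_mul_i := by simp [hij] }
  let φ : ℍ[ℝ] →ₐ[ℝ] A := B.liftHom
  refine ⟨(AlgEquiv.ofBijective φ ⟨φ.toRingHom.injective, ?_⟩).symm⟩
  intro a
  obtain ⟨p, q, r, s, rfl⟩ := h a
  refine ⟨⟨p, q, r, s⟩, ?_⟩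
  change algebraMap ℝ A p + q • i + r • j + s • (i * j) = _
  rw [Algebra.algebraMap_eq_smul_one]

/-- The real dimensions 1, 2 and 4 tell the three algebras apart. -/
theorem IsOfDivType.unique {A : Type*} [Semiring A] [Algebra ℝ A] {F F' : DivType}
    (h : IsOfDivType A F) (h' : IsOfDivType A F') : F = F' := by
  have key : ∀ F, IsOfDivType A F → Module.finrank ℝ A = match F with
      | .real => 1 | .complex => 2 | .quaternion => 4 := by
    rintro (_ | _ | _) ⟨e⟩
    · rw [e.toLinearEquiv.finrank_eq]; simp
    · rw [e.toLinearEquiv.finrank_eq]; simp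
    · rw [e.toLinearEquiv.finrank_eq]; exact Quaternion.finrank_eq_four
  have h1 := key F h
  have h2 := key F' h'
  rw [h1] at h2
  cases F <;> cases F' <;> simp_all

end Algebras

/-! ### Invariant subspaces and irreducible subrepresentations -/

section Basics

variable {k : Type*} [Field k] {H : Type*} [Group H] {V : Type*} [AddCommGroup V] [Module k V]

theorem Representation.IsIrreducible.nontrivial {ρ : Representation k H V}
    (h : ρ.IsIrreducible) : Nontrivial V := by
  by_contra hV
  rw [not_nontrivial_iff_subsingleton] at hV
  refine bot_ne_top (α := Subrepresentation ρ) ?_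
  ext v
  simp [Subsingleton.elim v 0, zero_mem]

theorem Representation.IsIrreducible.eq_bot_or_eq_top {ρ : Representation k H V}
    (h : ρ.IsIrreducible) (S : Submodule k V) (hS : ∀ g, ∀ v ∈ S, ρ g v ∈ S) : S = ⊥ ∨ S = ⊤ := by
  rcases h.2 ⟨S, fun g v hv => hS g v hv⟩ with h | h
  · left; exact congrArg Subrepresentation.toSubmodule h
  · right; exact congrArg Subrepresentation.toSubmodule h

theorem Representation.IsIrreducible.of_forall [Nontrivial V] {ρ : Representation k H V}
    (h : ∀ S : Submodule k V, (∀ g, ∀ v ∈ S, ρ g v ∈ S) → S = ⊥ ∨ S = ⊤) : ρ.IsIrreducible where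
  exists_pair_ne := ⟨⊥, ⊤, fun e => bot_ne_top (α := Submodule k V)
    (congrArg Subrepresentation.toSubmodule e)⟩
  eq_bot_or_eq_top a := by
    rcases h a.toSubmodule (fun g v hv => a.apply_mem_toSubmodule g hv) with h | h
    · left; exact Subrepresentation.toSubmodule_injective h
    · right; exact Subrepresentation.toSubmodule_injective h

/-- Among the nonzero submodules with a given property there is a minimal one. -/
theorem exists_minimal_submodule [FiniteDimensional k V] [Nontrivial V] (P : Submodule k V → Prop)
    (hP : P ⊤) : ∃ S : Submodule k V, S ≠ ⊥ ∧ P S ∧ ∀ T ≤ S, P T → T = ⊥ ∨ T = S := by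
  obtain ⟨S, ⟨h1, h2⟩, h3⟩ := WellFounded.has_min
    (wellFounded_lt (α := Submodule k V)) {S | S ≠ ⊥ ∧ P S} ⟨⊤, top_ne_bot, hP⟩
  refine ⟨S, h1, h2, fun T hT hPT => ?_⟩
  by_contra! hc
  exact h3 T ⟨hc.1, hPT⟩ (lt_of_le_of_ne hT hc.2)

/-- Every finite-dimensional representation contains an irreducible one. -/
theorem Representation.exists_irreducible_sub [FiniteDimensional k V] [Nontrivial V]
    (ρ : Representation k H V) : ∃ S : Subrepresentation ρ, S.toRepresentation.IsIrreducible := by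
  obtain ⟨S, h1, h2, h3⟩ := exists_minimal_submodule (k := k) (V := V)
    (fun S => ∀ g, ∀ v ∈ S, ρ g v ∈ S) (by simp)
  refine ⟨⟨S, fun g v hv => h2 g v hv⟩, ?_⟩
  have : Nontrivial S := Submodule.nontrivial_iff_ne_bot.mpr h1
  refine Representation.IsIrreducible.of_forall (fun T hT => ?_)
  have hT' : ∀ g, ∀ v ∈ T.map S.subtype, ρ g v ∈ T.map S.subtype := by
    rintro g _ ⟨v, hv, rfl⟩
    exact ⟨_, hT g v hv, rfl⟩
  rcases h3 (T.map S.subtype) (Submodule.map_subtype_le S T) hT' with h | h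
  · left
    exact Submodule.map_injective_of_injective S.subtype_injective (by simpa using h)
  · right
    apply Submodule.map_injective_of_injective S.subtype_injective
    simpa using h

end Basics

/-! ### Schur's lemma and orthogonality of irreducible characters -/

section Characters

variable {H : Type*} [Group H]

theorem Representation.IsIrreducible.schur {V : Type*} [AddCommGroup V] [Module ℂ V]
    [FiniteDimensional ℂ V] {ρ : Representation ℂ H V} (h : ρ.IsIrreducible) (L : V →ₗ[ℂ] V)
    (hL : ∀ g v, L (ρ g v) = ρ g (L v)) : ∃ a : ℂ, ∀ v, L v = a • v := by
  obtain ⟨a, ha⟩ := (Representation.IsIrreducible.algebraMap_intertwiningMap_bijective_of_isAlgClosed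
    (ρ := ρ)).2 (L.intertwiningMap_of_isIntertwiningMap ρ ρ hL)
  refine ⟨a, fun v => ?_⟩
  have := congrArg (fun φ : ρ.IntertwiningMap ρ => φ v) ha
  simpa [Representation.IntertwiningMap.smul_apply] using this.symm

/-- `χ` is an irreducible complex character. -/
def IsIrrChar (χ : H → ℂ) : Prop :=
  ∃ (V : Type) (_ : AddCommGroup V) (_ : Module ℂ V) (ρ : Representation ℂ H V), Affords ρ χ

theorem IsIrrChar.conj_apply {χ : H → ℂ} (hχ : IsIrrChar χ) (g h : H) :
    χ (h * g * h⁻¹) = χ g := by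
  obtain ⟨V, _, _, ρ, hV, hρ, rfl⟩ := hχ
  exact Representation.char_conj ρ g h

/-- The character of an irreducible representation is an irreducible character. -/
theorem IsIrrChar.of_rep {V : Type} [AddCommGroup V] [Module ℂ V] [FiniteDimensional ℂ V]
    {ρ : Representation ℂ H V} (h : ρ.IsIrreducible) : IsIrrChar ρ.character :=
  ⟨V, _, _, ρ, inferInstance, h, rfl⟩

/-- The bilinear pairing of class functions for which irreducible characters are orthonormal. -/
noncomputable def charPairing [Fintype H] (χ φ : H → ℂ) : ℂ :=
  (Nat.card H : ℂ)⁻¹ * ∑ g : H, χ g * φ g⁻¹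

theorem charPairing_add_left [Fintype H] (χ χ' φ : H → ℂ) :
    charPairing (χ + χ') φ = charPairing χ φ + charPairing χ' φ := by
  simp [charPairing, add_mul, Finset.sum_add_distrib, mul_add]

theorem charPairing_add_right [Fintype H] (χ φ φ' : H → ℂ) :
    charPairing χ (φ + φ') = charPairing χ φ + charPairing χ φ' := by
  simp [charPairing, mul_add, Finset.sum_add_distrib]

theorem IsIrrChar.pairing_self [Fintype H] {χ : H → ℂ} (hχ : IsIrrChar χ) :
    charPairing χ χ = 1 := by
  obtain ⟨V, _, _, ρ, hV, hρ, rfl⟩ := hχ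
  have : Invertible (Nat.card H : ℂ) := invertibleOfNonzero (by simp)
  rw [charPairing, Representation.char_orthonormal ρ ρ, if_pos ⟨Representation.Equiv.refl ρ⟩]

theorem IsIrrChar.pairing_of_ne [Fintype H] {χ φ : H → ℂ} (hχ : IsIrrChar χ) (hφ : IsIrrChar φ)
    (h : χ ≠ φ) : charPairing χ φ = 0 := by
  obtain ⟨V, _, _, ρ, hV, hρ, rfl⟩ := hχ
  obtain ⟨W, _, _, σ, hW, hσ, rfl⟩ := hφ
  have : Invertible (Nat.card H : ℂ) := invertibleOfNonzero (by simp)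
  rw [charPairing, Representation.char_orthonormal ρ σ, if_neg]
  rintro ⟨e⟩
  exact h (Representation.char_iso e).symm

/-- Orthonormality makes the irreducible characters linearly independent in the finite-dimensional
space of functions on `H`. Finiteness matters because `ncard` is `0` on infinite sets. -/
theorem finite_setOf_isIrrChar [Finite H] : {χ : H → ℂ | IsIrrChar χ}.Finite := by
  have := Fintype.ofFinite H
  refine LinearIndependent.set_finite_of_isNoetherian (R := ℂ) ?_
  rw [linearIndependent_iff']
  intro s c hc i hi
  have h1 : ∑ j ∈ s, c j * charPairing j.1 i.1 = 0 := by
    have : ∀ φ : H → ℂ, charPairing (∑ j ∈ s, c j • j.1) φ = ∑ j ∈ s, c j * charPairing j.1 φ := by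
      intro φ
      simp only [charPairing, Finset.sum_apply, Pi.smul_apply, smul_eq_mul, Finset.sum_mul,
        Finset.mul_sum]
      rw [Finset.sum_comm]
      refine Finset.sum_congr rfl fun j _ => Finset.sum_congr rfl fun g _ => by ring
    rw [← this]
    rw [hc]
    simp [charPairing]
  rw [Finset.sum_eq_single i] at h1
  · rwa [i.2.pairing_self, mul_one] at h1
  · intro j _ hj
    rw [IsIrrChar.pairing_of_ne j.2 i.2 (fun h => hj (Subtype.ext h)), mul_zero]
  · exact fun h => absurd hi h

/-- Pulling an irreducible representation back along a surjection keeps it irreducible. -/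
theorem Representation.IsIrreducible.comp_surjective {K : Type*} [Group K] {V : Type*}
    [AddCommGroup V] [Module ℂ V] {ρ : Representation ℂ H V} (h : ρ.IsIrreducible) (α : K →* H)
    (hα : Function.Surjective α) :
    Representation.IsIrreducible (ρ.comp α : Representation ℂ K V) := by
  have := h.nontrivial
  refine Representation.IsIrreducible.of_forall fun S hS => h.eq_bot_or_eq_top S fun g v hv => ?_
  obtain ⟨g, rfl⟩ := hα g
  exact hS g v hv

theorem IsIrrChar.comp_surjective {K : Type*} [Group K] {χ : H → ℂ} (hχ : IsIrrChar χ)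
    (α : K →* H) (hα : Function.Surjective α) : IsIrrChar (fun g => χ (α g)) := by
  obtain ⟨V, _, _, ρ, hV, hρ, rfl⟩ := hχ
  exact ⟨V, _, _, ρ.comp α, hV, hρ.comp_surjective α hα, rfl⟩

end Characters

/-! ### Antilinear intertwiners between a representation and its twist -/

section Twisted

variable {G : Type*} [Group G] {V : Type*} [AddCommGroup V] [Module ℂ V]

/-- An antilinear map intertwining `ρ` with its twist by `α`. -/
def IsTwisted (ρ : Representation ℂ G V) (α : G →* G) (K : V →ₛₗ[starRingEnd ℂ] V) : Prop :=
  ∀ g v, K (ρ g v) = ρ (α g) (K v)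

theorem IsTwisted.smul {ρ : Representation ℂ G V} {α : G →* G} {K : V →ₛₗ[starRingEnd ℂ] V}
    (hK : IsTwisted ρ α K) (c : ℂ) : IsTwisted ρ α (c • K) := by
  intro g v
  simp [hK g v]

variable [FiniteDimensional ℂ V] {ρ : Representation ℂ G V} {α : G →* G} {b : G}

/-- The composite of two antilinear maps is linear, and it intertwines `ρ` with its twist by `α ∘
α`, which is conjugation by `b`. So `ρ b⁻¹ ∘ K ∘ N` commutes with `ρ`, and Schur's lemma applies. -/
theorem Representation.IsIrreducible.twisted_comp (hρ : ρ.IsIrreducible)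
    (hα : ∀ g, α (α g) = b * g * b⁻¹) {K N : V →ₛₗ[starRingEnd ℂ] V}
    (hK : IsTwisted ρ α K) (hN : IsTwisted ρ α N) : ∃ c : ℂ, ∀ v, K (N v) = c • ρ b v := by
  obtain ⟨c, hc⟩ := hρ.schur ((ρ b⁻¹).comp (K.comp N)) (fun g v => by
    simp only [LinearMap.comp_apply]
    rw [hN, hK, hα, ← Module.End.mul_apply, ← map_mul, ← Module.End.mul_apply, ← map_mul]
    congr 2
    group)
  refine ⟨c, fun v => ?_⟩
  have := congrArg (ρ b) (hc v)
  simp only [LinearMap.comp_apply] at this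
  rwa [← Module.End.mul_apply, ← map_mul, mul_inv_cancel, map_one, Module.End.one_apply,
    map_smul] at this

/-- A nonzero `K` has `K ^ 2 = c • ρ b`. Computing `K ^ 3` in two ways, with `α b = b`, shows that
`c` is real. Replacing `K` by `t • K` multiplies `c` by `|t| ^ 2`, so `c` can be normalised to its
sign and no further. -/
theorem Representation.IsIrreducible.twisted_trichotomy (hρ : ρ.IsIrreducible)
    (hα : ∀ g, α (α g) = b * g * b⁻¹) (hb : α b = b) :
    (∀ K : V →ₛₗ[starRingEnd ℂ] V, IsTwisted ρ α K → K = 0) ∨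
    (∃ K : V →ₛₗ[starRingEnd ℂ] V, IsTwisted ρ α K ∧ ∀ v, K (K v) = ρ b v) ∨
    (∃ K : V →ₛₗ[starRingEnd ℂ] V, IsTwisted ρ α K ∧ ∀ v, K (K v) = -ρ b v) := by
  by_cases h : ∀ K : V →ₛₗ[starRingEnd ℂ] V, IsTwisted ρ α K → K = 0
  · exact Or.inl h
  right
  push Not at h
  obtain ⟨K, hK, hK0⟩ := h
  obtain ⟨c, hc⟩ := hρ.twisted_comp hα hK hK
  have hinj : ∀ v, K v = 0 → v = 0 := by
    rcases hρ.eq_bot_or_eq_top (LinearMap.ker K) (fun g v hv => by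
      simp only [LinearMap.mem_ker] at hv ⊢
      rw [hK, hv, map_zero]) with h | h
    · intro v hv
      have : v ∈ LinearMap.ker K := hv
      rwa [h] at this
    · exact absurd (LinearMap.ker_eq_top.mp h) hK0
  have hinj' : ∀ g v, ρ g v = 0 → v = 0 := fun g v hv => by
    have := congrArg (ρ g⁻¹) hv
    rwa [← Module.End.mul_apply, ← map_mul, inv_mul_cancel, map_one, Module.End.one_apply,
      map_zero] at this
  obtain ⟨v, hv⟩ : ∃ v, K v ≠ 0 := by
    by_contra! hh
    exact hK0 (LinearMap.ext hh)
  have hreal : conj c = c := by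
    have h1 : K (K (K v)) = c • ρ b (K v) := hc (K v)
    have h2 : K (K (K v)) = conj c • ρ b (K v) := by
      rw [hc v, map_smulₛₗ, hK, hb]
    rw [h1] at h2
    exact (smul_left_injective ℂ (fun h0 => hv (hinj' _ _ h0)) h2).symm
  have hc0 : c ≠ 0 := by
    rintro rfl
    have := hc v
    rw [zero_smul] at this
    exact hv (hinj _ this)
  obtain ⟨r, rfl⟩ := Complex.conj_eq_iff_real.mp hreal
  have hr0 : r ≠ 0 := by simpa using hc0
  have hs : (Real.sqrt |r|) ^ 2 = |r| := Real.sq_sqrt (abs_nonneg r)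
  have key : ∀ v, ((((Real.sqrt |r|)⁻¹ : ℝ) : ℂ) • K) (((((Real.sqrt |r|)⁻¹ : ℝ) : ℂ) • K) v) =
      ((|r|⁻¹ * r : ℝ) : ℂ) • ρ b v := by
    intro v
    simp only [LinearMap.smul_apply, map_smulₛₗ, Complex.conj_ofReal]
    rw [hc, smul_smul, smul_smul, ← Complex.ofReal_mul, ← Complex.ofReal_mul, ← mul_inv, ← sq, hs]
  rcases lt_or_gt_of_ne hr0 with hr | hr
  · right
    refine ⟨_, hK.smul (((Real.sqrt |r|)⁻¹ : ℝ) : ℂ), fun v => ?_⟩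
    rw [key, abs_of_neg hr, inv_neg, neg_mul, inv_mul_cancel₀ hr0]
    simp
  · left
    refine ⟨_, hK.smul (((Real.sqrt |r|)⁻¹ : ℝ) : ℂ), fun v => ?_⟩
    rw [key, abs_of_pos hr, inv_mul_cancel₀ hr0]
    simp

/-- Antilinear twisted intertwiners form a complex line once there is an invertible one. -/
theorem Representation.IsIrreducible.twisted_eq_smul (hρ : ρ.IsIrreducible)
    (hα : ∀ g, α (α g) = b * g * b⁻¹) (hb : α b = b) {K N : V →ₛₗ[starRingEnd ℂ] V}
    (hK : IsTwisted ρ α K) (hN : IsTwisted ρ α N) {s : ℂ} (hs : s ≠ 0)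
    (hKK : ∀ v, K (K v) = s • ρ b v) : ∃ d : ℂ, ∀ v, N v = d • K v := by
  obtain ⟨c, hc⟩ := hρ.twisted_comp hα hK hN
  -- With `K ∘ N = c • ρ b`, applying `K` once more gives `s • ρ b (N v) = conj c • ρ b (K v)`;
  -- cancelling `ρ b` yields the constant.
  refine ⟨s⁻¹ * conj c, fun v => ?_⟩
  have h1 : K (K (N v)) = s • ρ b (N v) := hKK _
  rw [hc, map_smulₛₗ, hK, hb, ← map_smul (ρ b), ← map_smul (ρ b)] at h1
  have h2 := congrArg (ρ b⁻¹) h1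
  simp only [← Module.End.mul_apply, ← map_mul, inv_mul_cancel, map_one, Module.End.one_apply] at h2
  rw [mul_smul, h2, smul_smul, inv_mul_cancel₀ hs, one_smul]

end Twisted

/-! ### Unitary matrix form -/

section Unitary

open Matrix
open scoped ComplexOrder MatrixOrder

variable {G : Type*} [Group G] {V : Type*} [AddCommGroup V] [Module ℂ V] [FiniteDimensional ℂ V]

/-- Averaging gives an invariant positive definite form `h`. Factoring it as `h = Sᴴ * S` and
changing basis by `S` turns invariance of `h` into unitarity. -/
theorem Representation.exists_unitary [Finite G] (ρ : Representation ℂ G V) :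
    ∃ (n : ℕ) (e : V ≃ₗ[ℂ] (Fin n → ℂ)) (R : G →* Matrix (Fin n) (Fin n) ℂ),
      (∀ g, (R g)ᴴ * R g = 1) ∧ ∀ g v, e (ρ g v) = R g *ᵥ e v := by
  have := Fintype.ofFinite G
  let b := Module.finBasis ℂ V
  let R₀ : G →* Matrix (Fin (Module.finrank ℂ V)) (Fin (Module.finrank ℂ V)) ℂ :=
    (LinearMap.toMatrixAlgEquiv b : _ →* _).comp ρ
  have hR₀ : ∀ g v, b.equivFun (ρ g v) = R₀ g *ᵥ b.equivFun v := by
    intro g v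
    simp [R₀, LinearMap.toMatrixAlgEquiv, LinearMap.toMatrix_mulVec_repr]
  let h := ∑ g, (R₀ g)ᴴ * R₀ g
  have hinv : ∀ g, R₀ g⁻¹ * R₀ g = 1 := fun g => by rw [← map_mul, inv_mul_cancel, map_one]
  have hpos : h.PosDef := by
    refine Matrix.posDef_sum Finset.univ_nonempty fun g _ => ?_
    refine Matrix.PosDef.conjTranspose_mul_self _ ?_
    exact Matrix.mulVec_injective_of_isUnit (IsUnit.of_mul_eq_one_right _ (hinv g))
  obtain ⟨S, hSu, hS⟩ := CStarAlgebra.isStrictlyPositive_iff_eq_star_mul_self.mp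
    hpos.isStrictlyPositive
  rw [Matrix.star_eq_conjTranspose] at hS
  have hdet : IsUnit S.det := (Matrix.isUnit_iff_isUnit_det S).mp hSu
  have hR₀h : ∀ g, (R₀ g)ᴴ * h * R₀ g = h := by
    intro g
    simp only [h, Finset.mul_sum, Finset.sum_mul]
    refine Fintype.sum_equiv (Equiv.mulRight g) _ _ fun x => ?_
    simp [map_mul, Matrix.conjTranspose_mul, Matrix.mul_assoc]
  let R : G →* Matrix (Fin (Module.finrank ℂ V)) (Fin (Module.finrank ℂ V)) ℂ :=
    { toFun := fun g => S * R₀ g * S⁻¹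
      map_one' := by rw [map_one, mul_one, Matrix.mul_nonsing_inv _ hdet]
      map_mul' := fun g g' => by
        rw [map_mul]
        simp only [Matrix.mul_assoc]
        rw [← Matrix.mul_assoc S⁻¹ S, Matrix.nonsing_inv_mul _ hdet, Matrix.one_mul] }
  let E : (Fin (Module.finrank ℂ V) → ℂ) ≃ₗ[ℂ] (Fin (Module.finrank ℂ V) → ℂ) :=
    Matrix.toLinearEquiv' S (Matrix.invertibleOfIsUnitDet S hdet)
  have hE : ∀ v, E v = S *ᵥ v := fun v => rfl
  refine ⟨_, b.equivFun.trans E, R, fun g => ?_, fun g v => ?_⟩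
  · change (S * R₀ g * S⁻¹)ᴴ * (S * R₀ g * S⁻¹) = 1
    rw [Matrix.conjTranspose_mul, Matrix.conjTranspose_mul]
    calc _ = S⁻¹ᴴ * ((R₀ g)ᴴ * (Sᴴ * S) * R₀ g) * S⁻¹ := by simp only [Matrix.mul_assoc]
      _ = (S * S⁻¹)ᴴ * (S * S⁻¹) := by
        rw [← hS, hR₀h, hS, Matrix.conjTranspose_mul]; simp only [Matrix.mul_assoc]
      _ = 1 := by rw [Matrix.mul_nonsing_inv _ hdet]; simp
  · simp only [LinearEquiv.trans_apply, hE, hR₀]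
    change _ = (S * R₀ g * S⁻¹) *ᵥ (S *ᵥ _)
    simp only [Matrix.mulVec_mulVec]
    rw [Matrix.mul_assoc (S * R₀ g), Matrix.nonsing_inv_mul _ hdet, Matrix.mul_one]

end Unitary

/-! ### Schur orthogonality and the values of the twisted indicator -/

section Indicator

open Matrix

/-- The Frobenius-Schur indicator twisted by an endomorphism `α` and an element `b`. -/
noncomputable def twistedIndicator {G : Type*} [Group G] [Fintype G] (α : G →* G) (b : G)
    (χ : G → ℂ) : ℂ :=
  (Nat.card G : ℂ)⁻¹ * ∑ g, χ (α g * b * g)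

variable {G : Type*} [Group G] {V : Type*} [AddCommGroup V] [Module ℂ V]
  [FiniteDimensional ℂ V] {ρ : Representation ℂ G V} {n : ℕ} {e : V ≃ₗ[ℂ] (Fin n → ℂ)}
  {R : G →* Matrix (Fin n) (Fin n) ℂ}

theorem character_eq_trace (he : ∀ g v, e (ρ g v) = R g *ᵥ e v) (g : G) :
    ρ.character g = (R g).trace := by
  have : e.conj (ρ g) = Matrix.toLin' (R g) := by
    ext v
    simp [LinearEquiv.conj_apply, he]
  rw [Representation.character, ← LinearMap.trace_conj' (ρ g) e, this, Matrix.trace_toLin'_eq]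

/-- Schur's lemma in matrix form. -/
theorem Representation.IsIrreducible.matrix_schur (hρ : ρ.IsIrreducible)
    (he : ∀ g v, e (ρ g v) = R g *ᵥ e v) (Q : Matrix (Fin n) (Fin n) ℂ)
    (hQ : ∀ g, Q * R g = R g * Q) : ∃ a : ℂ, Q = a • (1 : Matrix (Fin n) (Fin n) ℂ) := by
  obtain ⟨a, ha⟩ := hρ.schur (e.symm.toLinearMap ∘ₗ Matrix.toLin' Q ∘ₗ e.toLinearMap) (fun g v => by
    apply e.injective
    simp [he, hQ])
  refine ⟨a, Matrix.toLin'.injective (LinearMap.ext fun v => ?_)⟩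
  have := congrArg e (ha (e.symm v))
  simpa using this

theorem map_mul_conjTranspose_eq_one (hR : ∀ g, (R g)ᴴ * R g = 1) (g : G) : R g * (R g)ᴴ = 1 :=
  mul_eq_one_comm.mp (hR g)

theorem map_inv_eq_conjTranspose (hR : ∀ g, (R g)ᴴ * R g = 1) (g : G) : R g⁻¹ = (R g)ᴴ := by
  calc R g⁻¹ = (R g)ᴴ * R g * R g⁻¹ := by rw [hR, one_mul]
    _ = _ := by rw [mul_assoc, ← map_mul, mul_inv_cancel, map_one, mul_one]

/-- Schur orthogonality for the coefficients of an irreducible unitary representation. -/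
theorem Representation.IsIrreducible.sum_coeff_mul_conj [Fintype G] (hρ : ρ.IsIrreducible)
    (he : ∀ g v, e (ρ g v) = R g *ᵥ e v) (hR : ∀ g, (R g)ᴴ * R g = 1) (i j k l : Fin n) :
    (n : ℂ) * ∑ g, R g i j * conj (R g k l) = if i = k ∧ j = l then (Nat.card G : ℂ) else 0 := by
  -- The average of a matrix unit over the group commutes with every `R h`, hence is scalar. Its
  -- trace determines the scalar, and its `(i, k)` entry is the sum sought.
  let X : Matrix (Fin n) (Fin n) ℂ := Matrix.single j l 1
  obtain ⟨a, ha⟩ := hρ.matrix_schur he (∑ g, R g * X * (R g)ᴴ) (fun h => by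
    rw [Finset.sum_mul, Finset.mul_sum]
    refine Fintype.sum_equiv (Equiv.mulLeft h⁻¹) _ _ fun g => ?_
    simp only [Equiv.coe_mulLeft, map_mul, Matrix.conjTranspose_mul, map_inv_eq_conjTranspose hR,
      Matrix.conjTranspose_conjTranspose]
    simp only [← Matrix.mul_assoc]
    rw [map_mul_conjTranspose_eq_one hR, one_mul])
  have h1 : (n : ℂ) * a = if j = l then (Nat.card G : ℂ) else 0 := by
    have := congrArg Matrix.trace ha
    rw [Matrix.trace_sum, Matrix.trace_smul, Matrix.trace_one] at this
    have h2 : ∀ g, (R g * X * (R g)ᴴ).trace = if j = l then 1 else 0 := by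
      intro g
      rw [Matrix.trace_mul_comm, ← Matrix.mul_assoc, hR, one_mul]
      split_ifs with hjl
      · subst hjl; simp [X]
      · simp [X, Matrix.trace_single_eq_of_ne _ _ _ hjl]
    simp only [h2, Finset.sum_const, Finset.card_univ, smul_eq_mul, Fintype.card_fin,
      nsmul_eq_mul] at this
    rw [mul_comm, ← this, Nat.card_eq_fintype_card]
    simp
  have h3 := congrArg (fun M : Matrix (Fin n) (Fin n) ℂ => M i k) ha
  have h4 : ∀ g, (R g * X * (R g)ᴴ) i k = R g i j * conj (R g k l) := by
    intro g
    simp [X, Matrix.mul_apply, Matrix.single_apply, ite_and, Matrix.conjTranspose_apply]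
  simp only [Matrix.sum_apply, h4, Matrix.smul_apply, Matrix.one_apply] at h3
  rw [h3, smul_eq_mul, ← mul_assoc, h1]
  split_ifs <;> simp_all

/-- If there is no twisted antilinear intertwiner then the coefficients of `ρ` and of its twist
are orthogonal. -/
theorem sum_coeff_twist_mul [Fintype G] {α : G →* G} (hK : ∀ K : V →ₛₗ[starRingEnd ℂ] V,
      IsTwisted ρ α K → K = 0)
    (he : ∀ g v, e (ρ g v) = R g *ᵥ e v) (hR : ∀ g, (R g)ᴴ * R g = 1) (i j k l : Fin n) :
    ∑ g, R (α g) i j * R g k l = 0 := by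
  let X : Matrix (Fin n) (Fin n) ℂ := Matrix.single j l 1
  -- Because `P` intertwines the entrywise conjugate of `R` with `R ∘ α`, the map `v ↦ P * conj v`
  -- is a twisted antilinear intertwiner, so it vanishes by hypothesis; the entries of `P` are the
  -- sums in question.
  let P : Matrix (Fin n) (Fin n) ℂ := ∑ g, R (α g) * X * (R g)ᵀ
  have hP : ∀ h, P * (R h).map conj = R (α h) * P := by
    intro h
    simp only [P]
    rw [Finset.sum_mul, Finset.mul_sum]
    refine Fintype.sum_equiv (Equiv.mulLeft h⁻¹) _ _ fun g => ?_
    have h1 : (R h).map conj = (R h⁻¹)ᵀ := by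
      rw [map_inv_eq_conjTranspose hR]; rfl
    have h2 : R (α h) * R (α h⁻¹) = 1 := by
      rw [← map_mul, ← map_mul, mul_inv_cancel, map_one, map_one]
    simp only [Equiv.coe_mulLeft, map_mul, Matrix.transpose_mul, h1]
    simp only [← Matrix.mul_assoc]
    rw [h2, one_mul]
  let K : V →ₛₗ[starRingEnd ℂ] V :=
    { toFun := fun v => e.symm (P *ᵥ star (e v))
      map_add' := fun v w => by simp [Matrix.mulVec_add]
      map_smul' := fun c v => by simp [Matrix.mulVec_smul] }
  have hK0 := hK K (fun g v => by
    apply e.injective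
    change e (e.symm _) = e (ρ (α g) (e.symm _))
    rw [he, he, LinearEquiv.apply_symm_apply, LinearEquiv.apply_symm_apply, Matrix.mulVec_mulVec,
      ← hP, ← Matrix.mulVec_mulVec]
    congr 1
    ext i
    simp [Matrix.mulVec, dotProduct])
  have hP0 : P = 0 := by
    refine Matrix.toLin'.injective (LinearMap.ext fun v => ?_)
    have := congrArg (fun K : V →ₛₗ[starRingEnd ℂ] V => e (K (e.symm (star v)))) hK0
    simpa [K] using this
  have h3 := congrArg (fun M : Matrix (Fin n) (Fin n) ℂ => M i k) hP0
  have h4 : ∀ g, (R (α g) * X * (R g)ᵀ) i k = R (α g) i j * R g k l := by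
    intro g
    simp [X, Matrix.mul_apply, Matrix.single_apply, ite_and]
  simpa only [P, Matrix.sum_apply, h4, Matrix.zero_apply] using h3

/-- Both sums expand into the coefficient sums that vanish by `sum_coeff_twist_mul`. The second one
is used later to show that the twist of the character is not its complex conjugate. -/
theorem twistedIndicator_eq_zero [Fintype G] {α : G →* G} (b : G)
    (hK : ∀ K : V →ₛₗ[starRingEnd ℂ] V, IsTwisted ρ α K → K = 0) :
    twistedIndicator α b ρ.character = 0 ∧ ∑ g, ρ.character (α g) * ρ.character g = 0 := by
  obtain ⟨n, e, R, hR, he⟩ := ρ.exists_unitary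
  constructor
  · rw [twistedIndicator]
    have : ∀ g, ρ.character (α g * b * g) =
        ∑ i, ∑ k, ∑ j, R b j k * (R (α g) i j * R g k i) := by
      intro g
      rw [character_eq_trace he]
      simp only [map_mul, Matrix.trace, Matrix.diag, Matrix.mul_apply, Finset.sum_mul]
      refine Finset.sum_congr rfl fun i _ => Finset.sum_congr rfl fun k _ =>
        Finset.sum_congr rfl fun j _ => by ring
    simp only [this]
    rw [Finset.sum_comm]
    refine mul_eq_zero_of_right _ (Finset.sum_eq_zero fun i _ => ?_)
    rw [Finset.sum_comm]
    refine Finset.sum_eq_zero fun k _ => ?_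
    rw [Finset.sum_comm]
    refine Finset.sum_eq_zero fun j _ => ?_
    rw [← Finset.mul_sum, sum_coeff_twist_mul hK he hR, mul_zero]
  · simp only [character_eq_trace he, Matrix.trace, Matrix.diag, Finset.sum_mul_sum]
    rw [Finset.sum_comm]
    refine Finset.sum_eq_zero fun i _ => ?_
    rw [Finset.sum_comm]
    refine Finset.sum_eq_zero fun k _ => sum_coeff_twist_mul hK he hR _ _ _ _

theorem map_conj_mul {m : ℕ} (A B : Matrix (Fin m) (Fin m) ℂ) :
    (A * B).map conj = A.map conj * B.map conj :=
  Matrix.map_mul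

theorem exists_matrix_of_semilinear (e : V ≃ₗ[ℂ] (Fin n → ℂ)) (K : V →ₛₗ[starRingEnd ℂ] V) :
    ∃ A : Matrix (Fin n) (Fin n) ℂ, ∀ v, e (K v) = A *ᵥ star (e v) := by
  let L : (Fin n → ℂ) →ₗ[ℂ] (Fin n → ℂ) :=
    { toFun := fun v => e (K (e.symm (star v)))
      map_add' := fun v w => by simp
      map_smul' := fun c v => by simp [map_smulₛₗ] }
  refine ⟨LinearMap.toMatrix' L, fun v => ?_⟩
  rw [LinearMap.toMatrix'_mulVec]
  simp [L]

theorem star_mulVec_eq (A : Matrix (Fin n) (Fin n) ℂ) (v : Fin n → ℂ) :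
    star (A *ᵥ v) = A.map conj *ᵥ star v := by
  ext i
  simp [Matrix.mulVec, dotProduct]

theorem eq_of_mulVec_star (e : V ≃ₗ[ℂ] (Fin n → ℂ)) {A B : Matrix (Fin n) (Fin n) ℂ}
    (h : ∀ v, A *ᵥ star (e v) = B *ᵥ star (e v)) : A = B := by
  refine Matrix.toLin'.injective (LinearMap.ext fun v => ?_)
  simpa using h (e.symm (star v))

theorem eq_of_mulVec (e : V ≃ₗ[ℂ] (Fin n → ℂ)) {A B : Matrix (Fin n) (Fin n) ℂ}
    (h : ∀ v, A *ᵥ e v = B *ᵥ e v) : A = B := by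
  refine Matrix.toLin'.injective (LinearMap.ext fun v => ?_)
  simpa using h (e.symm v)

/-- In unitary coordinates `K` is `v ↦ A * conj v`, and `A` turns out to be unitary, so `R (α g)` is
the conjugate of `R g` up to the change of basis `A`. This gives the statement on characters at
once. Substituting it, together with `R b = s • (A * conj A)`, into the trace of `R (α g * b * g)`
leaves products of a coefficient with a conjugate coefficient, which Schur orthogonality sums to `s
* |G|`. -/
theorem twistedIndicator_eq [Fintype G] {α : G →* G} {b : G} (hρ : ρ.IsIrreducible)
    {K : V →ₛₗ[starRingEnd ℂ] V} (hK : IsTwisted ρ α K) {s : ℂ} (hs : s = 1 ∨ s = -1)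
    (hKK : ∀ v, K (K v) = s • ρ b v) :
    twistedIndicator α b ρ.character = s ∧
      ∀ g, ρ.character (α g) = conj (ρ.character g) := by
  obtain ⟨n, e, R, hR, he⟩ := ρ.exists_unitary
  obtain ⟨A, hA⟩ := exists_matrix_of_semilinear e K
  have hss : s * conj s = 1 := by rcases hs with rfl | rfl <;> simp
  have hAR : ∀ g, A * (R g).map conj = R (α g) * A := by
    intro g
    refine eq_of_mulVec_star e fun v => ?_
    rw [← Matrix.mulVec_mulVec, ← Matrix.mulVec_mulVec, ← star_mulVec_eq, ← he, ← hA, ← hA, ← he, hK]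
  have hAA : A * A.map conj = s • R b := by
    refine eq_of_mulVec e fun v => ?_
    have := congrArg e (hKK v)
    rw [hA, hA, star_mulVec_eq, star_star, Matrix.mulVec_mulVec, map_smul, he] at this
    rw [this, Matrix.smul_mulVec]
  have hn : Nonempty (Fin n) := by
    have := hρ.nontrivial
    by_contra hn
    rw [not_nonempty_iff] at hn
    obtain ⟨v, hv⟩ := exists_ne (0 : V)
    exact hv (e.injective (Subsingleton.elim _ _))
  have hn0 : (n : ℂ) ≠ 0 := by
    have := Fin.pos_iff_nonempty.mpr hn
    exact_mod_cast this.ne'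
  have hcc : ∀ M : Matrix (Fin n) (Fin n) ℂ, (M.map conj).map conj = M := by
    intro M; ext i j; simp
  have hT : ∀ M : Matrix (Fin n) (Fin n) ℂ, (M.map conj)ᴴ = Mᵀ := by
    intro M; ext i j; simp
  -- `Aᴴ * A` is scalar
  obtain ⟨m, hm⟩ := hρ.matrix_schur he ((Aᴴ * A).map conj) (fun g => by
    have h1 : (R g).map conj * Aᴴ = Aᴴ * R (α g) := by
      have h2 := congrArg Matrix.conjTranspose (hAR g⁻¹)
      rw [Matrix.conjTranspose_mul, Matrix.conjTranspose_mul, hT, map_inv α,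
        map_inv_eq_conjTranspose hR, map_inv_eq_conjTranspose hR,
        Matrix.conjTranspose_conjTranspose] at h2
      exact h2
    have h2 : (Aᴴ * A) * (R g).map conj = (R g).map conj * (Aᴴ * A) := by
      rw [Matrix.mul_assoc, hAR, ← Matrix.mul_assoc, ← h1, Matrix.mul_assoc]
    have h3 := congrArg (fun M : Matrix (Fin n) (Fin n) ℂ => M.map conj) h2
    simpa only [map_conj_mul, hcc] using h3)
  have hm' : Aᴴ * A = conj m • (1 : Matrix (Fin n) (Fin n) ℂ) := by
    rw [← hcc (Aᴴ * A), hm]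
    ext i j
    by_cases hij : i = j
    · subst hij; simp
    · simp [hij]
  -- The scalar in `Aᴴ * A` is the squared norm of a column of `A`, hence nonnegative. Its square is
  -- `1` because `A * conj A = s • R b` is unitary.
  have hm1 : Aᴴ * A = 1 := by
    obtain ⟨i⟩ := hn
    have h1 : (A * A.map conj)ᴴ * (A * A.map conj) =
        (conj m * m) • (1 : Matrix (Fin n) (Fin n) ℂ) := by
      have h0 : (A.map conj)ᴴ * A.map conj = m • (1 : Matrix (Fin n) (Fin n) ℂ) := by
        rw [← hm, map_conj_mul]
        rfl
      rw [Matrix.conjTranspose_mul, Matrix.mul_assoc, ← Matrix.mul_assoc Aᴴ, hm',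
        Matrix.smul_mul, Matrix.one_mul, Matrix.mul_smul, h0, smul_smul]
    rw [hAA, Matrix.conjTranspose_smul, Matrix.smul_mul, Matrix.mul_smul, hR, smul_smul] at h1
    have h2 : conj m * m = 1 := by
      have := congrArg (fun M : Matrix (Fin n) (Fin n) ℂ => M i i) h1
      simpa [mul_comm _ s, hss] using this.symm
    have h3 : conj m = ((∑ k, Complex.normSq (A k i) : ℝ) : ℂ) := by
      have := congrArg (fun M : Matrix (Fin n) (Fin n) ℂ => M i i) hm'
      simp only [Matrix.mul_apply, Matrix.conjTranspose_apply, Matrix.smul_apply,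
        Matrix.one_apply_eq, smul_eq_mul, mul_one] at this
      rw [← this, Complex.ofReal_sum]
      exact Finset.sum_congr rfl fun k _ => (Complex.normSq_eq_conj_mul_self).symm
    have hpos : 0 ≤ ∑ k, Complex.normSq (A k i) :=
      Finset.sum_nonneg fun k _ => Complex.normSq_nonneg _
    have h4 : m = ((∑ k, Complex.normSq (A k i) : ℝ) : ℂ) := by
      rw [← Complex.conj_conj m, h3, Complex.conj_ofReal]
    rw [h3, h4, ← Complex.ofReal_mul] at h2
    have h5 : (∑ k, Complex.normSq (A k i)) * (∑ k, Complex.normSq (A k i)) = 1 := by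
      exact_mod_cast h2
    have h6 : ∑ k, Complex.normSq (A k i) = 1 := by nlinarith
    rw [hm', h3, h6]
    simp
  have hAu : A * Aᴴ = 1 := mul_eq_one_comm.mp hm1
  have hRα : ∀ g, R (α g) = A * (R g).map conj * Aᴴ := by
    intro g
    rw [hAR, Matrix.mul_assoc, hAu, Matrix.mul_one]
  constructor
  · have hs2 : s * s = 1 := by rcases hs with rfl | rfl <;> simp
    have hRb : R b = s • (A * A.map conj) := by rw [hAA, smul_smul, hs2, one_smul]
    have h1 : ∀ g, ρ.character (α g * b * g) =
        s * ∑ i, ∑ l, ∑ k, ∑ j, A i j * conj (A k l) * (R g l i * conj (R g j k)) := by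
      intro g
      rw [character_eq_trace he, map_mul, map_mul, hRα, hRb, Matrix.mul_smul, Matrix.smul_mul,
        Matrix.trace_smul, smul_eq_mul]
      congr 1
      have : A * (R g).map conj * Aᴴ * (A * A.map conj) * R g =
          A * (R g).map conj * A.map conj * R g := by
        rw [← Matrix.mul_assoc, Matrix.mul_assoc _ Aᴴ A, hm1, Matrix.mul_one]
      rw [this]
      simp only [Matrix.trace, Matrix.diag, Matrix.mul_apply, Finset.sum_mul, Matrix.map_apply]
      refine Finset.sum_congr rfl fun i _ => Finset.sum_congr rfl fun l _ =>
        Finset.sum_congr rfl fun k _ => Finset.sum_congr rfl fun j _ => by ring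
    have h2 : (n : ℂ) * ∑ g, ρ.character (α g * b * g) = s * Nat.card G * n := by
      have h3 : ∑ g, ∑ i, ∑ l, ∑ k, ∑ j, A i j * conj (A k l) * (R g l i * conj (R g j k)) =
          ∑ i, ∑ l, ∑ k, ∑ j, A i j * conj (A k l) * ∑ g, R g l i * conj (R g j k) := by
        simp only [Finset.mul_sum]
        rw [Finset.sum_comm]
        refine Finset.sum_congr rfl fun i _ => ?_
        rw [Finset.sum_comm]
        refine Finset.sum_congr rfl fun l _ => ?_
        rw [Finset.sum_comm]
        refine Finset.sum_congr rfl fun k _ => ?_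
        rw [Finset.sum_comm]
      have h4 : ∀ i j k l, (n : ℂ) * (A i j * conj (A k l) * ∑ g, R g l i * conj (R g j k)) =
          if l = j ∧ i = k then A i j * conj (A i j) * Nat.card G else 0 := by
        intro i j k l
        rw [mul_left_comm, hρ.sum_coeff_mul_conj he hR]
        split_ifs with h
        · rw [h.1, h.2]
        · rw [mul_zero]
      have h5 : ∑ i, ∑ j, A i j * conj (A i j) = (n : ℂ) := by
        have := congrArg Matrix.trace hAu
        rw [Matrix.trace_one, Fintype.card_fin] at this
        rw [← this]
        simp [Matrix.trace, Matrix.mul_apply]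
      simp only [h1]
      rw [← Finset.mul_sum, h3, mul_left_comm]
      simp only [Finset.mul_sum (a := (n : ℂ)), h4, ite_and, Finset.sum_ite_eq, Finset.mem_univ,
        if_true]
      simp only [← Finset.sum_mul, h5]
      ring
    rw [twistedIndicator]
    have hc : (Nat.card G : ℂ) ≠ 0 := by simp
    field_simp
    have h6 := mul_left_cancel₀ hn0 (h2.trans (mul_comm _ _))
    rw [h6]
    ring
  · intro g
    rw [character_eq_trace he, character_eq_trace he, hRα, Matrix.trace_mul_comm,
      ← Matrix.mul_assoc, hm1, Matrix.one_mul]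
    simp [Matrix.trace]

end Indicator

/-! ### Real-linear, complex-linear and antilinear maps -/

section RealLinear

variable {V U : Type*} [AddCommGroup V] [Module ℂ V] [AddCommGroup U] [Module ℂ U]

theorem Complex.smul_eq_re_add_im (c : ℂ) (v : V) :
    c • v = c.re • v + c.im • (Complex.I • v) := by
  rw [← Complex.coe_smul, ← Complex.coe_smul c.im, smul_smul, ← add_smul, Complex.re_add_im]

/-- A real-linear map commuting with `I`, as a complex-linear map. -/
def complexLinearOfReal (Φ : V →ₗ[ℝ] U)
    (h : ∀ v, Φ (Complex.I • v) = Complex.I • Φ v) : V →ₗ[ℂ] U where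
  toFun := Φ
  map_add' := map_add Φ
  map_smul' c v := by
    rw [Complex.smul_eq_re_add_im, map_add, map_smul, map_smul, h, RingHom.id_apply,
      Complex.smul_eq_re_add_im c (Φ v)]

/-- A real-linear map anticommuting with `I`, as an antilinear map. -/
def LinearMap.antilinearOfReal (Φ : V →ₗ[ℝ] U)
    (h : ∀ v, Φ (Complex.I • v) = -(Complex.I • Φ v)) : V →ₛₗ[starRingEnd ℂ] U where
  toFun := Φ
  map_add' := map_add Φ
  map_smul' c v := by
    rw [Complex.smul_eq_re_add_im, map_add, map_smul, map_smul, h,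
      Complex.smul_eq_re_add_im (conj c) (Φ v)]
    simp

@[simp]
theorem complexLinearOfReal_apply (Φ : V →ₗ[ℝ] U) (h) (v : V) :
    complexLinearOfReal Φ h v = Φ v := rfl

@[simp]
theorem LinearMap.antilinearOfReal_apply (Φ : V →ₗ[ℝ] U) (h) (v : V) :
    Φ.antilinearOfReal h v = Φ v := rfl

/-- The real-linear map underlying an antilinear map. -/
def LinearMap.realOfAntilinear (K : V →ₛₗ[starRingEnd ℂ] U) : V →ₗ[ℝ] U where
  toFun := K
  map_add' := map_add K
  map_smul' r v := by
    rw [← Complex.coe_smul, map_smulₛₗ, Complex.conj_ofReal, Complex.coe_smul, RingHom.id_apply]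

@[simp]
theorem LinearMap.realOfAntilinear_apply (K : V →ₛₗ[starRingEnd ℂ] U) (v : V) :
    LinearMap.realOfAntilinear K v = K v := rfl

theorem antilinear_I (K : V →ₛₗ[starRingEnd ℂ] U) (v : V) :
    K (Complex.I • v) = -(Complex.I • K v) := by
  rw [map_smulₛₗ, Complex.conj_I, neg_smul]

end RealLinear

/-- The value of the Frobenius-Schur indicator belonging to a division algebra. -/
noncomputable def DivType.sign : DivType → ℂ
  | .real => 1
  | .complex => 0
  | .quaternion => -1

theorem DivType.sign_injective : Function.Injective DivType.sign := by
  intro F F' h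
  cases F <;> cases F' <;> simp_all [DivType.sign] <;> norm_num at h

/-! ### The classical indicator and the simple real module -/

section RealType

variable {H : Type*} [Group H] {V : Type*} [AddCommGroup V] [Module ℂ V]
  {W : Type*} [AddCommGroup W] [Module ℝ W]
  {ρ : Representation ℂ H V} {σ : Representation ℝ H W}

/-- With `J` multiplication by `I`, the maps `(Φ - J Φ J) / 2` and `(Φ + J Φ J) / 2` are the linear
and antilinear parts of `Φ`; both still commute with `ρ`, so the first is a scalar by Schur's lemma.
-/
theorem Representation.IsIrreducible.real_endomorphism [FiniteDimensional ℂ V]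
    (hρ : ρ.IsIrreducible) (Φ : V →ₗ[ℝ] V) (hΦ : ∀ g v, Φ (ρ g v) = ρ g (Φ v)) :
    ∃ (a : ℂ) (N : V →ₛₗ[starRingEnd ℂ] V), IsTwisted ρ (MonoidHom.id H) N ∧
      ∀ v, Φ v = a • v + N v := by
  let J : V →ₗ[ℝ] V := (LinearMap.lsmul ℂ V Complex.I).restrictScalars ℝ
  have hJ : ∀ v, J v = Complex.I • v := fun v => rfl
  have hII : ∀ v : V, Complex.I • Complex.I • v = -v := fun v => by
    rw [smul_smul, Complex.I_mul_I, neg_one_smul]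
  let L : V →ₗ[ℂ] V := complexLinearOfReal ((1 / 2 : ℝ) • (Φ - J.comp (Φ.comp J))) (fun v => by
    simp only [LinearMap.smul_apply, LinearMap.sub_apply, LinearMap.comp_apply, hJ, hII, map_neg,
      smul_neg, smul_sub, smul_comm Complex.I (1 / 2 : ℝ)]
    abel)
  let N : V →ₛₗ[starRingEnd ℂ] V :=
    LinearMap.antilinearOfReal ((1 / 2 : ℝ) • (Φ + J.comp (Φ.comp J))) (fun v => by
    simp only [LinearMap.smul_apply, LinearMap.add_apply, LinearMap.comp_apply, hJ, hII, map_neg,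
      smul_neg, smul_add, smul_comm Complex.I (1 / 2 : ℝ)]
    abel)
  obtain ⟨a, ha⟩ := hρ.schur L (fun g v => by
    simp only [L, complexLinearOfReal_apply, LinearMap.smul_apply, LinearMap.sub_apply,
      LinearMap.comp_apply, hJ]
    rw [← map_smul (ρ g), hΦ, hΦ, ← map_smul (ρ g), ← map_sub, ← Complex.coe_smul, ← map_smul,
      Complex.coe_smul])
  refine ⟨a, N, fun g v => ?_, fun v => ?_⟩
  · simp only [N, LinearMap.antilinearOfReal_apply, LinearMap.smul_apply, LinearMap.add_apply,
      LinearMap.comp_apply, hJ, MonoidHom.id_apply]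
    rw [← map_smul (ρ g), hΦ, hΦ, ← map_smul (ρ g), ← map_add, ← Complex.coe_smul, ← map_smul,
      Complex.coe_smul]
  · rw [← ha]
    simp only [L, N, complexLinearOfReal_apply, LinearMap.antilinearOfReal_apply,
      LinearMap.smul_apply, LinearMap.add_apply, LinearMap.sub_apply]
    rw [← smul_add]
    rw [show ∀ x y : V, x - y + (x + y) = (2 : ℝ) • x from fun x y => by rw [two_smul]; abel]
    rw [smul_smul]
    norm_num

theorem intertwiningMap_nontrivial {k : Type*} [Field k] {W : Type*} [AddCommGroup W] [Module k W]
    [Nontrivial W] (σ : Representation k H W) : Nontrivial (σ.IntertwiningMap σ) := by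
  obtain ⟨w, hw⟩ := exists_ne (0 : W)
  refine ⟨1, 0, fun h => hw ?_⟩
  exact congrArg (fun φ : σ.IntertwiningMap σ => φ w) h

theorem injective_of_equivariant (hσ : σ.IsIrreducible) {f : W →ₗ[ℝ] V} (hf0 : f ≠ 0)
    (hf : ∀ h w, f (σ h w) = ρ h (f w)) : Function.Injective f := by
  rw [← LinearMap.ker_eq_bot]
  refine (hσ.eq_bot_or_eq_top (LinearMap.ker f) fun g v hv => ?_).resolve_right
    fun h => hf0 (LinearMap.ker_eq_top.mp h)
  rw [LinearMap.mem_ker] at hv ⊢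
  rw [hf, hv, map_zero]

/-- Here `W` is `V` with scalars restricted to ℝ, so its endomorphisms are sums of a complex scalar
and an antilinear intertwiner. Without a nonzero antilinear intertwiner this is ℂ; with `K ^ 2 = -1`
the map `K` serves as `j` and gives ℍ. -/
theorem endomorphism_type_of_surjective [Fintype H] [FiniteDimensional ℂ V]
    (hρ : ρ.IsIrreducible) (hσ : σ.IsIrreducible) {f : W →ₗ[ℝ] V} (hf0 : f ≠ 0)
    (hf : ∀ h w, f (σ h w) = ρ h (f w)) (hsurj : Function.Surjective f) :
    ∃ F, IsOfDivType (σ.IntertwiningMap σ) F ∧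
      twistedIndicator (MonoidHom.id H) 1 ρ.character = F.sign := by
  have hinj := injective_of_equivariant hσ hf0 hf
  have := hσ.nontrivial
  have := intertwiningMap_nontrivial σ
  let e : W ≃ₗ[ℝ] V := LinearEquiv.ofBijective f ⟨hinj, hsurj⟩
  have he : ∀ w, e w = f w := fun w => rfl
  have hes : ∀ g v, e.symm (ρ g v) = σ g (e.symm v) := fun g v => by
    apply e.injective
    rw [he (σ g _), hf, ← he, LinearEquiv.apply_symm_apply, LinearEquiv.apply_symm_apply]
  have hmk : ∀ Φ : V →ₗ[ℝ] V, (∀ g v, Φ (ρ g v) = ρ g (Φ v)) →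
      ∃ φ : σ.IntertwiningMap σ, ∀ w, f (φ w) = Φ (f w) := by
    intro Φ hΦ
    refine ⟨LinearMap.intertwiningMap_of_isIntertwiningMap σ σ (e.symm.toLinearMap ∘ₗ Φ ∘ₗ f)
      (fun g w => ?_), fun w => ?_⟩
    · simp [hf, hΦ, hes]
    · change e (e.symm (Φ (f w))) = _
      rw [LinearEquiv.apply_symm_apply]
  have hext : ∀ φ ψ : σ.IntertwiningMap σ, (∀ w, f (φ w) = f (ψ w)) → φ = ψ := by
    intro φ ψ h
    exact DFunLike.ext _ _ fun w => hinj (h w)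
  have hdec : ∀ φ : σ.IntertwiningMap σ, ∃ (a : ℂ) (N : V →ₛₗ[starRingEnd ℂ] V),
      IsTwisted ρ (MonoidHom.id H) N ∧ ∀ w, f (φ w) = a • f w + N (f w) := by
    intro φ
    obtain ⟨a, N, hN, h⟩ := hρ.real_endomorphism (f ∘ₗ φ.toLinearMap ∘ₗ e.symm.toLinearMap)
      (fun g v => by
        simp only [LinearMap.comp_apply, LinearEquiv.coe_coe, hes]
        rw [Representation.IntertwiningMap.toLinearMap_apply, φ.isIntertwining, hf]
        rfl)
    refine ⟨a, N, hN, fun w => ?_⟩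
    rw [← h, ← he w]
    simp
  obtain ⟨i, hi⟩ := hmk ((LinearMap.lsmul ℂ V Complex.I).restrictScalars ℝ) (fun g v => by simp)
  replace hi : ∀ w, f (i w) = Complex.I • f w := hi
  have hii : i * i = (-1 : ℝ) • (1 : σ.IntertwiningMap σ) := by
    refine hext _ _ fun w => ?_
    rw [Representation.IntertwiningMap.mul_apply, hi, hi, smul_smul, Complex.I_mul_I,
      Representation.IntertwiningMap.smul_apply, map_smul]
    simp
  rcases hρ.twisted_trichotomy (α := MonoidHom.id H) (b := 1) (by simp) (by simp) with
    hK | ⟨K, hK, hKK⟩ | ⟨K, hK, hKK⟩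
  · refine ⟨.complex, isOfDivType_complex i hii fun φ => ?_, (twistedIndicator_eq_zero 1 hK).1⟩
    obtain ⟨a, N, hN, h⟩ := hdec φ
    refine ⟨a.re, a.im, hext _ _ fun w => ?_⟩
    rw [h, hK N hN, Complex.smul_eq_re_add_im]
    change _ = f (a.re • w + a.im • i w)
    simp [hi]
  -- If `K ^ 2 = 1`, the fixed vectors of `K` form an invariant real subspace. It is neither zero
  -- nor everything, since otherwise `K` would be `-1` or `1`, which is not antilinear; this
  -- contradicts simplicity of `W`.
  · exfalso
    let S : Submodule ℝ W := LinearMap.ker (LinearMap.realOfAntilinear K ∘ₗ f - f)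
    have hS : ∀ w, w ∈ S ↔ K (f w) = f w := fun w => by simp [S, sub_eq_zero]
    obtain ⟨w, hw⟩ := exists_ne (0 : W)
    have hfw : f w ≠ 0 := fun h => hw (hinj (h.trans (map_zero f).symm))
    have key : ∀ v : V, v ≠ 0 → ∀ c : ℂ, c • v = - c • v → c = 0 := by
      intro v hv c hc
      have := smul_left_injective ℂ hv hc
      have h2 : (2 : ℂ) * c = 0 := by linear_combination this
      simpa using h2
    rcases hσ.eq_bot_or_eq_top S (fun g w hw => by
      rw [hS] at hw ⊢
      rw [hf, hK, hw]
      rfl) with h | h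
    · have h1 : ∀ v : V, K v = -v := by
        intro v
        have : e.symm (v + K v) ∈ S := by
          rw [hS, ← he, LinearEquiv.apply_symm_apply, map_add, hKK]
          simp [add_comm]
        rw [h, Submodule.mem_bot] at this
        have h2 := congrArg e this
        rw [LinearEquiv.apply_symm_apply, map_zero] at h2
        exact (neg_eq_of_add_eq_zero_right h2).symm
      have h3 := antilinear_I K (f w)
      rw [h1, h1, smul_neg, neg_neg] at h3
      exact Complex.I_ne_zero (key _ hfw _ (by rw [neg_smul]; exact h3.symm))
    · have h1 : ∀ v : V, K v = v := by
        intro v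
        have : e.symm v ∈ S := by rw [h]; trivial
        rwa [hS, ← he, LinearEquiv.apply_symm_apply] at this
      have h3 := antilinear_I K (f w)
      rw [h1, h1] at h3
      exact Complex.I_ne_zero (key _ hfw _ (by rw [neg_smul]; exact h3))
  · obtain ⟨j, hj⟩ := hmk (LinearMap.realOfAntilinear K) (fun g v => hK g v)
    replace hj : ∀ w, f (j w) = K (f w) := hj
    refine ⟨.quaternion, isOfDivType_quaternion i j hii ?_ ?_ fun φ => ?_, ?_⟩
    · refine hext _ _ fun w => ?_
      rw [Representation.IntertwiningMap.mul_apply, hj, hj, hKK,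
        Representation.IntertwiningMap.smul_apply, map_smul]
      simp
    · refine hext _ _ fun w => ?_
      rw [Representation.IntertwiningMap.mul_apply, hj, hi,
        Representation.IntertwiningMap.smul_apply, map_smul f,
        Representation.IntertwiningMap.mul_apply, hi, hj, antilinear_I]
      rw [neg_smul, one_smul]
    · obtain ⟨a, N, hN, h⟩ := hdec φ
      obtain ⟨d, hd⟩ := hρ.twisted_eq_smul (b := 1) (by simp) (by simp) hK hN
        (neg_ne_zero.mpr (one_ne_zero (α := ℂ))) (fun v => by rw [hKK, neg_one_smul])
      refine ⟨a.re, a.im, d.re, d.im, hext _ _ fun w => ?_⟩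
      rw [h, hd, Complex.smul_eq_re_add_im, Complex.smul_eq_re_add_im d]
      change _ = f (a.re • w + a.im • i w + d.re • j w + d.im • i (j w))
      simp [hi, hj, add_assoc]
    · exact (twistedIndicator_eq hρ hK (Or.inr rfl) (fun v => by rw [hKK, neg_one_smul])).1

/-- Now `W` is a real form: `V = W ⊕ I • W`. Conjugation with respect to `W` is an antilinear
intertwiner with square `1`. -/
theorem endomorphism_type_of_not_surjective [Fintype H] [FiniteDimensional ℂ V]
    (hρ : ρ.IsIrreducible) (hσ : σ.IsIrreducible) {f : W →ₗ[ℝ] V} (hf0 : f ≠ 0)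
    (hf : ∀ h w, f (σ h w) = ρ h (f w)) (hsurj : ¬ Function.Surjective f) :
    IsOfDivType (σ.IntertwiningMap σ) .real ∧
      twistedIndicator (MonoidHom.id H) 1 ρ.character = 1 := by
  have hinj := injective_of_equivariant hσ hf0 hf
  have := hσ.nontrivial
  have := intertwiningMap_nontrivial σ
  have hII : ∀ v : V, Complex.I • Complex.I • v = -v := fun v => by
    rw [smul_smul, Complex.I_mul_I, neg_one_smul]
  let J : V →ₗ[ℝ] V := (LinearMap.lsmul ℂ V Complex.I).restrictScalars ℝ
  let E₀ : W × W →ₗ[ℝ] V := f.coprod (J ∘ₗ f)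
  have hE₀ : ∀ w w', E₀ (w, w') = f w + Complex.I • f w' := fun w w' => by simp [E₀, J]
  have hE₀g : ∀ g w w', ρ g (E₀ (w, w')) = E₀ (σ g w, σ g w') := fun g w w' => by
    simp [hE₀, hf]
  -- The intersection of `f W` with `I • f W` is a complex invariant subspace, and it is proper
  -- because `f` is not surjective.
  have hzero : ∀ w w', f w = Complex.I • f w' → w' = 0 := by
    let S : Submodule ℂ V :=
      { carrier := {v | v ∈ LinearMap.range f ∧ Complex.I • v ∈ LinearMap.range f}
        add_mem' := fun ha hb => ⟨add_mem ha.1 hb.1, by rw [smul_add]; exact add_mem ha.2 hb.2⟩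
        zero_mem' := ⟨zero_mem _, by rw [smul_zero]; exact zero_mem _⟩
        smul_mem' := fun c v hv => by
          constructor
          · rw [Complex.smul_eq_re_add_im]
            exact add_mem (Submodule.smul_mem _ _ hv.1) (Submodule.smul_mem _ _ hv.2)
          · rw [smul_comm, Complex.smul_eq_re_add_im, hII]
            exact add_mem (Submodule.smul_mem _ _ hv.2)
              (Submodule.smul_mem _ _ (neg_mem hv.1)) }
    have hS : S = ⊥ := by
      refine (hρ.eq_bot_or_eq_top S ?_).resolve_right fun h => hsurj fun v => ?_
      · rintro g v ⟨⟨w, hw⟩, ⟨w', hw'⟩⟩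
        exact ⟨⟨σ g w, by rw [hf, hw]⟩, ⟨σ g w', by rw [hf, hw', map_smul]⟩⟩
      · have : v ∈ S := by rw [h]; trivial
        exact this.1
    intro w w' h
    have : f w' ∈ S := ⟨⟨w', rfl⟩, ⟨w, h⟩⟩
    rw [hS, Submodule.mem_bot] at this
    exact hinj (this.trans (map_zero f).symm)
  have hE₀inj : Function.Injective E₀ := by
    rw [← LinearMap.ker_eq_bot, LinearMap.ker_eq_bot']
    rintro ⟨w, w'⟩ h
    rw [hE₀] at h
    have h1 : w' = 0 := by
      refine neg_eq_zero.mp (hzero w (-w') ?_)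
      rw [map_neg, smul_neg]
      exact eq_neg_of_add_eq_zero_left h
    subst h1
    rw [map_zero, smul_zero, add_zero] at h
    rw [hinj (h.trans (map_zero f).symm)]
    rfl
  have hE₀surj : Function.Surjective E₀ := by
    let S : Submodule ℂ V :=
      { carrier := {v | v ∈ LinearMap.range E₀}
        add_mem' := fun {a b} ha hb => (LinearMap.range E₀).add_mem ha hb
        zero_mem' := zero_mem (LinearMap.range E₀)
        smul_mem' := fun c v hv => by
          change v ∈ LinearMap.range E₀ at hv
          change c • v ∈ LinearMap.range E₀
          rw [Complex.smul_eq_re_add_im]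
          refine add_mem (Submodule.smul_mem _ _ hv) (Submodule.smul_mem _ _ ?_)
          obtain ⟨⟨w, w'⟩, rfl⟩ := hv
          exact ⟨(-w', w), by rw [hE₀, hE₀, smul_add, hII, map_neg, add_comm]⟩ }
    have hS : S = ⊤ := by
      refine (hρ.eq_bot_or_eq_top S ?_).resolve_left fun h => hf0 (LinearMap.ext fun w => ?_)
      · rintro g _ ⟨⟨w, w'⟩, rfl⟩
        exact ⟨_, (hE₀g g w w').symm⟩
      · have : f w ∈ S := ⟨(w, 0), by simp [hE₀]⟩
        rwa [h, Submodule.mem_bot] at this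
    intro v
    have : v ∈ S := by rw [hS]; trivial
    exact this
  let E : (W × W) ≃ₗ[ℝ] V := LinearEquiv.ofBijective E₀ ⟨hE₀inj, hE₀surj⟩
  have hE : ∀ w w', E (w, w') = f w + Complex.I • f w' := hE₀
  have hEg : ∀ g w w', ρ g (E (w, w')) = E (σ g w, σ g w') := hE₀g
  have hEI : ∀ w w', Complex.I • E (w, w') = E (-w', w) := fun w w' => by
    rw [hE, hE, smul_add, hII, map_neg, add_comm]
  have hEsymm : ∀ v, ∃ w w', v = E (w, w') := fun v => ⟨(E.symm v).1, (E.symm v).2, by simp⟩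
  constructor
  · refine isOfDivType_real fun φ => ?_
    -- The complexification of `φ` is a complex scalar `a` by Schur's lemma. As it preserves the
    -- real form, comparing first coordinates leaves only `a.re`.
    let Φ : V →ₗ[ℝ] V :=
      E.toLinearMap ∘ₗ (φ.toLinearMap.prodMap φ.toLinearMap) ∘ₗ E.symm.toLinearMap
    have hΦ : ∀ w w', Φ (E (w, w')) = E (φ w, φ w') := fun w w' => by
      simp [Φ, Representation.IntertwiningMap.toLinearMap_apply]
    have hΦI : ∀ v, Φ (Complex.I • v) = Complex.I • Φ v := by
      intro v
      obtain ⟨w, w', rfl⟩ := hEsymm v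
      rw [hEI, hΦ, hΦ, hEI, map_neg]
    obtain ⟨a, ha⟩ := hρ.schur (complexLinearOfReal Φ hΦI) (fun g v => by
      obtain ⟨w, w', rfl⟩ := hEsymm v
      simp only [complexLinearOfReal_apply]
      rw [hEg, hΦ, hΦ, hEg, φ.isIntertwining, φ.isIntertwining])
    refine ⟨a.re, DFunLike.ext _ _ fun w => ?_⟩
    have h := ha (E (w, 0))
    rw [complexLinearOfReal_apply, hΦ, Complex.smul_eq_re_add_im, hEI, ← map_smul, ← map_smul,
      ← map_add] at h
    have := congrArg Prod.fst (E.injective h)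
    simpa [Representation.IntertwiningMap.smul_apply] using this
  · let K₀ : V →ₗ[ℝ] V :=
      E.toLinearMap ∘ₗ (LinearMap.id.prodMap (-LinearMap.id)) ∘ₗ E.symm.toLinearMap
    have hK₀ : ∀ w w', K₀ (E (w, w')) = E (w, -w') := fun w w' => by simp [K₀]
    have hK₀I : ∀ v, K₀ (Complex.I • v) = -(Complex.I • K₀ v) := by
      intro v
      obtain ⟨w, w', rfl⟩ := hEsymm v
      rw [hEI, hK₀, hK₀, hEI, ← map_neg]
      simp
    let K : V →ₛₗ[starRingEnd ℂ] V := K₀.antilinearOfReal hK₀I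
    refine (twistedIndicator_eq hρ (K := K) ?_ (Or.inl rfl) fun v => ?_).1
    · intro g v
      obtain ⟨w, w', rfl⟩ := hEsymm v
      simp only [K, LinearMap.antilinearOfReal_apply, MonoidHom.id_apply]
      rw [hEg, hK₀, hK₀, hEg, map_neg]
    · obtain ⟨w, w', rfl⟩ := hEsymm v
      simp only [K, LinearMap.antilinearOfReal_apply]
      rw [hK₀, hK₀]
      simp

end RealType

/-- The type is independent of the chosen simple real module, since each admissible one yields the
same indicator. For existence, any simple real submodule of `V` will do. -/
theorem hasCharType_iff {H : Type*} [Group H] [Fintype H] (χ : H → ℂ) (F : DivType) :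
    HasCharType χ F ↔ IsIrrChar χ ∧ twistedIndicator (MonoidHom.id H) 1 χ = F.sign := by
  constructor
  · rintro ⟨V, _, _, ρ, ⟨hV, hρ, rfl⟩, W, _, _, σ, hσ, ⟨f, hf0, hf⟩, hF⟩
    refine ⟨.of_rep hρ, ?_⟩
    by_cases hsurj : Function.Surjective f
    · obtain ⟨F', h1, h2⟩ := endomorphism_type_of_surjective hρ hσ hf0 hf hsurj
      rw [h2, h1.unique hF]
    · obtain ⟨h1, h2⟩ := endomorphism_type_of_not_surjective hρ hσ hf0 hf hsurj
      rw [h2, ← h1.unique hF]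
      rfl
  · rintro ⟨⟨V, _, _, ρ, hV, hρ, rfl⟩, hF⟩
    refine ⟨V, _, _, ρ, ⟨hV, hρ, rfl⟩, ?_⟩
    let ρ' : Representation ℝ H V :=
      { toFun := fun g => (ρ g).restrictScalars ℝ
        map_one' := by ext; simp
        map_mul' := fun g h => by ext; simp }
    have : FiniteDimensional ℝ V := FiniteDimensional.complexToReal V
    have := hρ.nontrivial
    obtain ⟨S, hS⟩ := ρ'.exists_irreducible_sub
    have hf0 : S.toSubmodule.subtype ≠ 0 := fun h => by
      have := hS.nontrivial
      obtain ⟨w, hw⟩ := exists_ne (0 : S.toSubmodule)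
      exact hw (Subtype.ext (congrArg (fun f : _ →ₗ[ℝ] V => f w) h))
    have hf : ∀ h w, S.toSubmodule.subtype (S.toRepresentation h w) =
      ρ h (S.toSubmodule.subtype w) := fun h w => rfl
    refine ⟨S.toSubmodule, _, _, S.toRepresentation, hS, ⟨S.toSubmodule.subtype, hf0, hf⟩, ?_⟩
    by_cases hsurj : Function.Surjective S.toSubmodule.subtype
    · obtain ⟨F', h1, h2⟩ := endomorphism_type_of_surjective hρ hS hf0 hf hsurj
      rwa [← DivType.sign_injective (h2.symm.trans hF)]
    · obtain ⟨h1, h2⟩ := endomorphism_type_of_not_surjective hρ hS hf0 hf hsurj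
      rwa [← DivType.sign_injective (show DivType.real.sign = F.sign from h2.symm.trans hF)]

/-! ### Induction from a subgroup of index two -/

section IndexTwo

variable {Γ : Type*} [Group Γ] {G : Subgroup Γ}

/-- Conjugation by `x` on a subgroup of index two. -/
def conjBy (hG : G.index = 2) (x : Γ) : G →* G :=
  haveI := Subgroup.normal_of_index_eq_two hG
  (MulAut.conjNormal x).toMonoidHom

@[simp]
theorem coe_conjBy (hG : G.index = 2) (x : Γ) (g : G) : (conjBy hG x g : Γ) = x * g * x⁻¹ := rfl

/-- The square of an element, which lies in any subgroup of index two. -/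
def squareIn (hG : G.index = 2) (x : Γ) : G := ⟨x * x, Subgroup.mul_self_mem_of_index_two hG x⟩

theorem conjBy_conjBy (hG : G.index = 2) (x : Γ) (g : G) :
    conjBy hG x (conjBy hG x g) = squareIn hG x * g * (squareIn hG x)⁻¹ := by
  ext
  simp [squareIn, mul_assoc]

theorem conjBy_squareIn (hG : G.index = 2) (x : Γ) :
    conjBy hG x (squareIn hG x) = squareIn hG x := by
  ext
  simp [squareIn, mul_assoc]

theorem conjBy_surjective (hG : G.index = 2) (x : Γ) : Function.Surjective (conjBy hG x) :=
  haveI := Subgroup.normal_of_index_eq_two hG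
  (MulAut.conjNormal x).surjective

theorem exists_eq_mul_of_notMem (hG : G.index = 2) {x y : Γ} (hx : x ∉ G) (hy : y ∉ G) :
    ∃ g : G, y = x * g :=
  ⟨⟨x⁻¹ * y, by
    rw [Subgroup.mul_mem_iff_of_index_two hG, inv_mem_iff]
    simp [hx, hy]⟩, by simp⟩

/-- A property closed under products holds on all of `Γ` if it holds on `G` and at `x ∉ G`. -/
theorem forall_of_index_two (hG : G.index = 2) {x : Γ} (hx : x ∉ G) {P : Γ → Prop}
    (h1 : ∀ g : G, P g) (h2 : P x) (hmul : ∀ y z, P y → P z → P (y * z)) (y : Γ) : P y := by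
  by_cases hy : y ∈ G
  · exact h1 ⟨y, hy⟩
  · obtain ⟨g, rfl⟩ := exists_eq_mul_of_notMem hG hx hy
    exact hmul _ _ h2 (h1 g)

variable {V : Type*} [AddCommGroup V] [Module ℂ V] (ρ : Representation ℂ G V)

open Classical in
/-- A representation of `G` extended by zero to `Γ`. -/
noncomputable def extendByZero (y : Γ) : V →ₗ[ℂ] V :=
  if h : y ∈ G then ρ ⟨y, h⟩ else 0

theorem extendByZero_coe (g : G) : extendByZero ρ (g : Γ) = ρ g := by
  simp [extendByZero]

theorem extendByZero_of_notMem {y : Γ} (hy : y ∉ G) : extendByZero ρ y = 0 := by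
  simp [extendByZero, hy]

/-- This is one entry of the block matrix product for the coset representatives `1` and `x`. Only
one summand survives: the first if `y ∈ G`, the second otherwise. -/
theorem extendByZero_mul (hG : G.index = 2) {x : Γ} (hx : x ∉ G) (y z : Γ) :
    extendByZero ρ (y * z) = extendByZero ρ y * extendByZero ρ z +
      extendByZero ρ (y * x⁻¹) * extendByZero ρ (x * z) := by
  have key : ∀ y z : Γ, y ∈ G → extendByZero ρ (y * z) = extendByZero ρ y * extendByZero ρ z := by
    intro y z hy
    by_cases hz : z ∈ G
    · lift y to G using hy
      lift z to G using hz
      rw [← Subgroup.coe_mul, extendByZero_coe, extendByZero_coe, extendByZero_coe, map_mul]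
    · rw [extendByZero_of_notMem ρ hz, mul_zero, extendByZero_of_notMem]
      rwa [Subgroup.mul_mem_cancel_left G hy]
  by_cases hy : y ∈ G
  · have : y * x⁻¹ ∉ G := by rwa [Subgroup.mul_mem_cancel_left G hy, inv_mem_iff]
    rw [key y z hy, extendByZero_of_notMem ρ this, zero_mul, add_zero]
  · have : y * x⁻¹ ∈ G := by
      rw [Subgroup.mul_mem_iff_of_index_two hG, inv_mem_iff]
      simp [hx, hy]
    rw [extendByZero_of_notMem ρ hy, zero_mul, zero_add, ← key _ _ this]
    congr 1
    group

/-- The representation of `Γ` induced from `G`, in block form. -/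
noncomputable def inducedBlock (hG : G.index = 2) {x : Γ} (hx : x ∉ G) :
    Representation ℂ Γ (V × V) where
  toFun y := LinearMap.prod
    ((extendByZero ρ y).coprod (extendByZero ρ (y * x⁻¹)))
    ((extendByZero ρ (x * y)).coprod (extendByZero ρ (x * y * x⁻¹)))
  map_one' := by
    have h1 : extendByZero ρ 1 = 1 := by
      rw [← Subgroup.coe_one G, extendByZero_coe, map_one]
    have hx' : x⁻¹ ∉ G := by rwa [inv_mem_iff]
    refine LinearMap.ext fun v => ?_
    simp [h1, extendByZero_of_notMem ρ hx, extendByZero_of_notMem ρ hx']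
  map_mul' y z := by
    refine LinearMap.ext fun v => Prod.ext ?_ ?_
    · simp only [LinearMap.prod_apply, Function.prod_apply, LinearMap.coprod_apply, Module.End.mul_apply]
      rw [extendByZero_mul ρ hG hx y z, mul_assoc y z, extendByZero_mul ρ hG hx y (z * x⁻¹)]
      simp only [LinearMap.add_apply, Module.End.mul_apply, map_add, mul_assoc]
      abel
    · simp only [LinearMap.prod_apply, Function.prod_apply, LinearMap.coprod_apply, Module.End.mul_apply]
      rw [← mul_assoc x y z, extendByZero_mul ρ hG hx (x * y) z, mul_assoc (x * y) z,
        extendByZero_mul ρ hG hx (x * y) (z * x⁻¹)]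
      simp only [LinearMap.add_apply, Module.End.mul_apply, map_add, mul_assoc]
      abel

variable (hG : G.index = 2) {x : Γ} (hx : x ∉ G)

theorem inducedBlock_coe (g : G) (v w : V) :
    inducedBlock ρ hG hx g (v, w) = (ρ g v, ρ (conjBy hG x g) w) := by
  have h1 : (g : Γ) * x⁻¹ ∉ G := by rwa [Subgroup.mul_mem_cancel_left G g.2, inv_mem_iff]
  have h2 : x * (g : Γ) ∉ G := by rwa [Subgroup.mul_mem_cancel_right G g.2]
  have h3 := extendByZero_coe ρ (conjBy hG x g)
  rw [coe_conjBy] at h3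
  simp [inducedBlock, extendByZero_of_notMem ρ h1, extendByZero_of_notMem ρ h2, h3,
    extendByZero_coe]

theorem inducedBlock_self (v w : V) :
    inducedBlock ρ hG hx x (v, w) = (w, ρ (squareIn hG x) v) := by
  have h1 : extendByZero ρ 1 = 1 := by
    rw [← Subgroup.coe_one G, extendByZero_coe, map_one]
  have h3 := extendByZero_coe ρ (squareIn hG x)
  simp only [squareIn] at h3
  simp [inducedBlock, extendByZero_of_notMem ρ hx, h1, h3, squareIn]

variable {ρ}

/-- An invariant subgroup of the induced representation of an irreducible representation, stable
under a possibly twisted scalar multiplication, is trivial or the graph of a bijection. -/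
theorem Representation.IsIrreducible.inducedBlock_trichotomy (hρ : ρ.IsIrreducible)
    (T : AddSubgroup (V × V)) (hTg : ∀ g : G, ∀ u ∈ T, inducedBlock ρ hG hx g u ∈ T)
    (hTx : ∀ u ∈ T, inducedBlock ρ hG hx x u ∈ T) (s : ℂ →+* ℂ) (hs : Function.Surjective s)
    (hTs : ∀ (c : ℂ) (v w : V), (v, w) ∈ T → (c • v, s c • w) ∈ T) :
    T = ⊥ ∨ T = ⊤ ∨ ((∀ w, (0, w) ∈ T → w = 0) ∧ (∀ v, ∃ w, (v, w) ∈ T) ∧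
      ∀ w, ∃ v, (v, w) ∈ T) := by
  -- The pair `(v, w)` stands for `v + x⁻¹ w`. `A` is the fibre of `T` over `0` and `B` its first
  -- projection, both invariant complex subspaces of `V`. Taking `s` to be the identity covers
  -- representations of `Γ`, and conjugation covers Real representations.
  let A : Submodule ℂ V :=
    { carrier := {w | (0, w) ∈ T}
      add_mem' := fun {a b} ha hb => by simpa using T.add_mem ha hb
      zero_mem' := T.zero_mem
      smul_mem' := fun c w hw => by
        obtain ⟨c, rfl⟩ := hs c
        simpa using hTs c 0 w hw }
  let B : Submodule ℂ V :=
    { carrier := {v | ∃ w, (v, w) ∈ T}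
      add_mem' := by
        rintro a b ⟨w, hw⟩ ⟨w', hw'⟩
        exact ⟨w + w', T.add_mem hw hw'⟩
      zero_mem' := ⟨0, T.zero_mem⟩
      smul_mem' := by
        rintro c v ⟨w, hw⟩
        exact ⟨_, hTs c v w hw⟩ }
  rcases hρ.eq_bot_or_eq_top A (fun g w hw => by
    obtain ⟨g, rfl⟩ := conjBy_surjective hG x g
    have := hTg g _ hw
    rwa [inducedBlock_coe, map_zero] at this) with hA | hA
  · have hA' : ∀ w, (0, w) ∈ T → w = 0 := fun w hw => by
      have : w ∈ A := hw
      rwa [hA, Submodule.mem_bot] at this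
    rcases hρ.eq_bot_or_eq_top B (fun g v ⟨w, hw⟩ => by
      have := hTg g _ hw
      rw [inducedBlock_coe] at this
      exact ⟨_, this⟩) with hB | hB
    · left
      rw [eq_bot_iff]
      rintro ⟨v, w⟩ h
      have : v ∈ B := ⟨w, h⟩
      rw [hB, Submodule.mem_bot] at this
      subst this
      rw [hA' w h]
      rfl
    · right; right
      have hB' : ∀ v, ∃ w, (v, w) ∈ T := fun v => by
        have : v ∈ B := by rw [hB]; trivial
        exact this
      refine ⟨hA', hB', fun w => ?_⟩
      -- Acting by `x` swaps the coordinates up to `ρ (x ^ 2)`, so surjectivity of the first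
      -- projection gives that of the second.
      obtain ⟨v, hv⟩ := hB' (ρ (squareIn hG x)⁻¹ w)
      have := hTx _ hv
      rw [inducedBlock_self, ← Module.End.mul_apply, ← map_mul, mul_inv_cancel, map_one] at this
      exact ⟨v, this⟩
  · right; left
    have hA' : ∀ w, (0, w) ∈ T := fun w => by
      have : w ∈ A := by rw [hA]; trivial
      exact this
    rw [eq_top_iff]
    rintro ⟨v, w⟩ -
    have h1 := hTx _ (hA' v)
    rw [inducedBlock_self, map_zero] at h1
    simpa using T.add_mem h1 (hA' w)

open Classical in
/-- The character induced from `G` to `Γ`. -/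
noncomputable def inducedChar (hG : G.index = 2) (x : Γ) (χ : G → ℂ) (y : Γ) : ℂ :=
  if h : y ∈ G then χ ⟨y, h⟩ + χ (conjBy hG x ⟨y, h⟩) else 0

theorem inducedChar_coe (χ : G → ℂ) (g : G) :
    inducedChar hG x χ g = χ g + χ (conjBy hG x g) := by
  simp [inducedChar]

theorem inducedChar_of_notMem (χ : G → ℂ) {y : Γ} (hy : y ∉ G) : inducedChar hG x χ y = 0 := by
  simp [inducedChar, hy]

variable [FiniteDimensional ℂ V]

theorem character_inducedBlock : (inducedBlock ρ hG hx).character = inducedChar hG x ρ.character := by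
  funext y
  by_cases hy : y ∈ G
  · lift y to G using hy
    rw [inducedChar_coe]
    have : inducedBlock ρ hG hx y = (ρ y).prodMap (ρ (conjBy hG x y)) := by
      refine LinearMap.ext fun ⟨v, w⟩ => ?_
      rw [inducedBlock_coe]
      rfl
    rw [Representation.character, this, LinearMap.trace_prodMap']
    rfl
  · rw [inducedChar_of_notMem _ _ hy]
    obtain ⟨g, rfl⟩ := exists_eq_mul_of_notMem hG hx hy
    -- Elements outside `G` act by off-diagonal blocks, so conjugation by `diag(1, -1)` negates them
    -- and the trace is zero.
    let D : (V × V) ≃ₗ[ℂ] (V × V) := (LinearEquiv.refl ℂ V).prodCongr (LinearEquiv.neg ℂ)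
    have hD : ∀ v w, D (v, w) = (v, -w) := fun v w => rfl
    have hDs : ∀ v w, D.symm (v, w) = (v, -w) := fun v w => by
      rw [LinearEquiv.symm_apply_eq, hD, neg_neg]
    have : D.conj (inducedBlock ρ hG hx (x * g)) = -inducedBlock ρ hG hx (x * g) := by
      refine LinearMap.ext fun ⟨v, w⟩ => ?_
      rw [LinearEquiv.conj_apply_apply, hDs, LinearMap.neg_apply, map_mul, Module.End.mul_apply,
        Module.End.mul_apply, inducedBlock_coe, inducedBlock_coe, inducedBlock_self,
        inducedBlock_self, hD]
      simp
    have h2 := LinearMap.trace_conj' (inducedBlock ρ hG hx (x * g)) D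
    rw [this, map_neg] at h2
    rw [Representation.character]
    linear_combination (-1 / 2 : ℂ) * h2

end IndexTwo

/-! ### Clifford theory in index two -/

section Clifford

variable {Γ : Type*} [Group Γ] {G : Subgroup Γ} (hG : G.index = 2) {x : Γ} (hx : x ∉ G)

include hx

/-- An irreducible character of `Γ` restricts to an irreducible character of `G` or is induced
from one. -/
theorem IsIrrChar.restrict_or_induced {ψ : Γ → ℂ} (hψ : IsIrrChar ψ) :
    IsIrrChar (fun g : G => ψ g) ∨ ∃ χ : G → ℂ, IsIrrChar χ ∧ ψ = inducedChar hG x χ := by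
  obtain ⟨U, _, _, τ, hU, hτ, rfl⟩ := hψ
  have := hτ.nontrivial
  obtain ⟨S, hρ⟩ := Representation.exists_irreducible_sub (τ.comp G.subtype : Representation ℂ G U)
  set V := S.toSubmodule
  set ρ := S.toRepresentation
  have := hρ.nontrivial
  let f : V →ₗ[ℂ] U := V.subtype
  have hf : ∀ (g : G) v, f (ρ g v) = τ g (f v) := fun g v => rfl
  have hfinj : Function.Injective f := V.subtype_injective
  -- Frobenius reciprocity: the inclusion of `V` extends to a `Γ`-map from the induced
  -- representation, surjective because `U` is simple. If its kernel is zero, `U` is induced. If the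
  -- kernel is a graph, then `x⁻¹ V` lies in `V`, so `V` is all of `U`.
  let E : V × V →ₗ[ℂ] U := f.coprod (τ x⁻¹ ∘ₗ f)
  have hE : ∀ v w, E (v, w) = f v + τ x⁻¹ (f w) := fun v w => by simp [E]
  have hEΓ : ∀ (y : Γ) (u : V × V), E (inducedBlock ρ hG hx y u) = τ y (E u) := by
    refine forall_of_index_two hG hx ?_ ?_ ?_
    · rintro g ⟨v, w⟩
      rw [inducedBlock_coe, hE, hE, map_add, hf, hf, coe_conjBy, ← Module.End.mul_apply,
        ← Module.End.mul_apply, ← map_mul, ← map_mul,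
        show x⁻¹ * (x * (g : Γ) * x⁻¹) = g * x⁻¹ by group]
    · rintro ⟨v, w⟩
      rw [inducedBlock_self, hE, hE, map_add, hf, ← Module.End.mul_apply,
        ← Module.End.mul_apply, ← map_mul, ← map_mul, mul_inv_cancel, map_one]
      simp [squareIn, add_comm]
    · intro y z hy hz u
      rw [map_mul, Module.End.mul_apply, hy, hz, map_mul, Module.End.mul_apply]
  obtain ⟨v₀, hv₀⟩ := exists_ne (0 : V)
  have hfv₀ : f v₀ ≠ 0 := fun h => hv₀ (hfinj (h.trans (map_zero f).symm))
  have hEsurj : Function.Surjective E := by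
    rw [← LinearMap.range_eq_top]
    refine (hτ.eq_bot_or_eq_top _ ?_).resolve_left fun h => hfv₀ ?_
    · rintro y _ ⟨u, rfl⟩
      exact ⟨_, hEΓ y u⟩
    · have : f v₀ ∈ LinearMap.range E := ⟨(v₀, 0), by simp [hE]⟩
      rwa [h, Submodule.mem_bot] at this
  have hT := hρ.inducedBlock_trichotomy hG hx (LinearMap.ker E).toAddSubgroup
    (fun g u hu => by
      have hu : E u = 0 := hu
      change E _ = 0
      rw [hEΓ, hu, map_zero])
    (fun u hu => by
      have hu : E u = 0 := hu
      change E _ = 0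
      rw [hEΓ, hu, map_zero])
    (RingHom.id ℂ) Function.surjective_id
    (fun c v w h => (LinearMap.ker E).smul_mem c h)
  rcases hT with hT | hT | ⟨-, -, hT⟩
  · right
    refine ⟨ρ.character, .of_rep hρ, ?_⟩
    have hEinj : Function.Injective E := by
      rw [← LinearMap.ker_eq_bot]
      exact Submodule.toAddSubgroup_injective hT
    rw [← character_inducedBlock hG hx]
    refine (Representation.char_iso (Representation.IntertwiningMap.ofBijective
      (E.intertwiningMap_of_isIntertwiningMap (inducedBlock ρ hG hx) τ hEΓ)
      ⟨hEinj, hEsurj⟩)).symm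
  · exfalso
    have : ((v₀, 0) : V × V) ∈ (LinearMap.ker E).toAddSubgroup := by rw [hT]; trivial
    have : E (v₀, 0) = 0 := this
    rw [hE] at this
    exact hfv₀ (by simpa using this)
  · left
    have hfsurj : Function.Surjective f := by
      intro u
      obtain ⟨⟨v, w⟩, rfl⟩ := hEsurj u
      obtain ⟨v', hv'⟩ := hT w
      have hv' : E (v', w) = 0 := hv'
      refine ⟨v - v', ?_⟩
      rw [hE] at hv' ⊢
      rw [map_sub, eq_neg_of_add_eq_zero_left hv', sub_neg_eq_add]
    have h1 : ρ.character = fun g : G => τ.character g :=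
      Representation.char_iso (Representation.IntertwiningMap.ofBijective
        (f.intertwiningMap_of_isIntertwiningMap ρ (τ.comp G.subtype : Representation ℂ G U) hf)
        ⟨hfinj, hfsurj⟩)
    rw [← h1]
    exact .of_rep hρ

/-- An irreducible character of `G` extends to `Γ` or induces irreducibly. -/
theorem IsIrrChar.extends_or_induces {χ : G → ℂ} (hχ : IsIrrChar χ) :
    (∃ ψ : Γ → ℂ, IsIrrChar ψ ∧ ∀ g : G, ψ g = χ g) ∨ IsIrrChar (inducedChar hG x χ) := by
  obtain ⟨V, _, _, ρ, hV, hρ, rfl⟩ := hχ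
  have := hρ.nontrivial
  obtain ⟨S, hS⟩ := (inducedBlock ρ hG hx).exists_irreducible_sub
  have := hS.nontrivial
  -- A simple submodule of the induced representation is either everything, so induction is
  -- irreducible, or a graph, in which case the first projection identifies its restriction to `G`
  -- with `V`.
  rcases hρ.inducedBlock_trichotomy hG hx S.toSubmodule.toAddSubgroup
    (fun g u hu => S.apply_mem_toSubmodule g hu) (fun u hu => S.apply_mem_toSubmodule x hu)
    (RingHom.id ℂ) Function.surjective_id
    (fun c v w h => S.toSubmodule.smul_mem c h) with hT | hT | ⟨hT, hT', -⟩
  · exfalso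
    have h1 : S.toSubmodule = ⊥ := Submodule.toAddSubgroup_injective hT
    obtain ⟨v, hv⟩ := exists_ne (0 : S.toSubmodule)
    have : (v : V × V) ∈ (⊥ : Submodule ℂ (V × V)) := h1.le v.2
    exact hv (Subtype.ext ((Submodule.mem_bot ℂ).mp this))
  · right
    have h1 : S.toSubmodule = ⊤ := Submodule.toAddSubgroup_injective hT
    rw [← character_inducedBlock hG hx, Representation.char_iso
      (Representation.IntertwiningMap.ofBijective
      (S.toSubmodule.subtype.intertwiningMap_of_isIntertwiningMap S.toRepresentation
        (inducedBlock ρ hG hx) fun g v => rfl)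
      ⟨S.toSubmodule.subtype_injective, fun u => ⟨⟨u, by rw [h1]; trivial⟩, rfl⟩⟩).symm]
    exact .of_rep hS
  · left
    refine ⟨S.toRepresentation.character, .of_rep hS, fun g => ?_⟩
    let p : S.toSubmodule →ₗ[ℂ] V := LinearMap.fst ℂ V V ∘ₗ S.toSubmodule.subtype
    have hp : ∀ (g : G) u, p (S.toRepresentation g u) = ρ g (p u) := by
      rintro g ⟨⟨v, w⟩, h⟩
      exact congrArg Prod.fst (inducedBlock_coe ρ hG hx g v w)
    have hpb : Function.Bijective p := by
      constructor
      · rw [← LinearMap.ker_eq_bot, LinearMap.ker_eq_bot']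
        rintro ⟨⟨v, w⟩, h⟩ (rfl : v = 0)
        exact Subtype.ext (Prod.ext rfl (hT w h))
      · intro v
        obtain ⟨w, hw⟩ := hT' v
        exact ⟨⟨(v, w), hw⟩, rfl⟩
    exact congrFun (Representation.char_iso (Representation.IntertwiningMap.ofBijective
      (p.intertwiningMap_of_isIntertwiningMap
        (S.toRepresentation.comp G.subtype : Representation ℂ G S.toSubmodule) ρ hp) hpb)) g

end Clifford

/-! ### Simple Real representations and their endomorphism algebras -/

namespace AntilinearRep

variable {Γ : Type*} [Group Γ] {G : Subgroup Γ}

section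

variable {U : Type*} [AddCommGroup U] [Module ℂ U]

/-- The restriction of a Real representation to an invariant subspace. -/
def restrict (τ : AntilinearRep G U) (S : Submodule ℂ U) (hS : ∀ g, ∀ u ∈ S, τ.act g u ∈ S) :
    AntilinearRep G S where
  act :=
    { toFun := fun g =>
        { toFun := fun u => ⟨τ.act g u, hS g u u.2⟩
          map_add' := fun u v => Subtype.ext (map_add (τ.act g) _ _)
          map_smul' := fun r u => Subtype.ext (map_smul (τ.act g) r (u : U)) }
      map_one' := by ext u; simp
      map_mul' := fun g h => by ext u; simp }
  act_smul_of_mem g hg c u := Subtype.ext (τ.act_smul_of_mem g hg c u)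
  act_smul_of_notMem g hg c u := Subtype.ext (τ.act_smul_of_notMem g hg c u)

theorem coe_restrict (τ : AntilinearRep G U) (S : Submodule ℂ U)
    (hS : ∀ g, ∀ u ∈ S, τ.act g u ∈ S) (g : Γ) (u : S) :
    (((τ.restrict S hS).act g u : S) : U) = τ.act g u := rfl

theorem exists_irreducible_sub [FiniteDimensional ℂ U] [Nontrivial U] (τ : AntilinearRep G U) :
    ∃ (S : Submodule ℂ U) (hS : ∀ g, ∀ u ∈ S, τ.act g u ∈ S), (τ.restrict S hS).IsIrreducible := by
  obtain ⟨S, h1, h2, h3⟩ := exists_minimal_submodule (k := ℂ) (V := U)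
    (fun S => ∀ g, ∀ v ∈ S, τ.act g v ∈ S) (by simp)
  refine ⟨S, h2, Submodule.nontrivial_iff_ne_bot.mpr h1, fun T hT => ?_⟩
  have hT' : ∀ g, ∀ v ∈ T.map S.subtype, τ.act g v ∈ T.map S.subtype := by
    rintro g _ ⟨v, hv, rfl⟩
    exact ⟨_, hT g v hv, rfl⟩
  rcases h3 (T.map S.subtype) (Submodule.map_subtype_le S T) hT' with h | h
  · left
    exact Submodule.map_injective_of_injective S.subtype_injective (by simpa using h)
  · right
    apply Submodule.map_injective_of_injective S.subtype_injective
    simpa using h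

end

/-- The space `V × V̄`. -/
def ConjPair (V : Type*) := V × V

section

variable {V : Type*} [AddCommGroup V] [Module ℂ V]

instance : AddCommGroup (ConjPair V) := inferInstanceAs (AddCommGroup (V × V))

noncomputable instance : Module ℂ (ConjPair V) where
  smul c u := (c • u.1, conj c • u.2)
  one_smul u := Prod.ext (one_smul ℂ u.1) (by change conj (1 : ℂ) • u.2 = u.2; simp)
  mul_smul c d u := Prod.ext (mul_smul c d u.1)
    (by change conj (c * d) • u.2 = conj c • conj d • u.2; rw [map_mul, mul_smul])
  smul_zero c := Prod.ext (smul_zero c) (smul_zero (conj c))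
  smul_add c u v := Prod.ext (smul_add c u.1 v.1) (smul_add (conj c) u.2 v.2)
  add_smul c d u := Prod.ext (add_smul c d u.1)
    (by change conj (c + d) • u.2 = conj c • u.2 + conj d • u.2; rw [map_add, add_smul])
  zero_smul u := Prod.ext (zero_smul ℂ u.1) (by change conj (0 : ℂ) • u.2 = 0; simp)

/-- The identity map onto `V × V̄`. -/
def ConjPair.of : V × V ≃+ ConjPair V := AddEquiv.refl (V × V)

theorem ConjPair.smul_of (c : ℂ) (v w : V) :
    c • ConjPair.of (v, w) = ConjPair.of (c • v, conj c • w) := rfl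

theorem ConjPair.real_smul_of (r : ℝ) (u : V × V) :
    r • ConjPair.of u = ConjPair.of ((r : ℂ) • u) := by
  rw [← Complex.coe_smul, ← Prod.mk.eta (p := u), ConjPair.smul_of, Complex.conj_ofReal]
  rfl

instance [FiniteDimensional ℂ V] : FiniteDimensional ℂ (ConjPair V) := by
  have : FiniteDimensional ℝ V := FiniteDimensional.complexToReal V
  let e : (V × V) →ₗ[ℝ] ConjPair V :=
    { toFun := ConjPair.of
      map_add' := map_add ConjPair.of
      map_smul' := fun r u => by
        rw [RingHom.id_apply, ConjPair.real_smul_of, Complex.coe_smul] }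
  have : FiniteDimensional ℝ (ConjPair V) :=
    Module.Finite.of_surjective e fun u => ⟨u, rfl⟩
  exact FiniteDimensional.right ℝ ℂ (ConjPair V)

/-- The Real representation induced from a complex representation of `G`. -/
noncomputable def induced (ρ : Representation ℂ G V) (hG : G.index = 2) {x : Γ} (hx : x ∉ G) :
    AntilinearRep G (ConjPair V) where
  act :=
    { toFun := fun y =>
        { toFun := fun u => ConjPair.of (inducedBlock ρ hG hx y (ConjPair.of.symm u))
          map_add' := fun u v => by rw [map_add, map_add, map_add]
          map_smul' := fun r u => by
            obtain ⟨u, rfl⟩ := ConjPair.of.surjective u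
            rw [RingHom.id_apply, ConjPair.real_smul_of, ConjPair.real_smul_of,
              AddEquiv.symm_apply_apply, AddEquiv.symm_apply_apply, map_smul] }
      map_one' := by
        refine LinearMap.ext fun u => ?_
        change ConjPair.of (inducedBlock ρ hG hx 1 (ConjPair.of.symm u)) = u
        rw [map_one]; rfl
      map_mul' := fun y z => by
        refine LinearMap.ext fun u => ?_
        change ConjPair.of (inducedBlock ρ hG hx (y * z) (ConjPair.of.symm u)) = _
        rw [map_mul]; rfl }
  act_smul_of_mem := by
    rintro g hg c ⟨v, w⟩
    lift g to G using hg
    change ConjPair.of (inducedBlock ρ hG hx g (c • v, conj c • w)) =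
      c • ConjPair.of (inducedBlock ρ hG hx g (v, w))
    rw [inducedBlock_coe, inducedBlock_coe, map_smul, map_smul]
    rfl
  act_smul_of_notMem := by
    rintro y hy c ⟨v, w⟩
    obtain ⟨g, rfl⟩ := exists_eq_mul_of_notMem hG hx hy
    change ConjPair.of (inducedBlock ρ hG hx (x * g) (c • v, conj c • w)) =
      conj c • ConjPair.of (inducedBlock ρ hG hx (x * g) (v, w))
    rw [map_mul, Module.End.mul_apply, Module.End.mul_apply, inducedBlock_coe, inducedBlock_coe,
      inducedBlock_self, inducedBlock_self, map_smul, map_smul, map_smul]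
    rw [ConjPair.smul_of, Complex.conj_conj]

end

/-- Every irreducible representation of `G` occurs in a simple Real representation. -/
theorem exists_irreducible_of_rep {V : Type} [AddCommGroup V] [Module ℂ V] [FiniteDimensional ℂ V]
    {ρ : Representation ℂ G V} (hρ : ρ.IsIrreducible) (hG : G.index = 2) {x : Γ} (hx : x ∉ G) :
    ∃ (U : Type) (_ : AddCommGroup U) (_ : Module ℂ U) (τ : AntilinearRep G U),
      τ.IsIrreducible ∧
      ∃ f : V →ₗ[ℂ] U, f ≠ 0 ∧ ∀ (g : G) (v : V), f (ρ g v) = τ.act (g : Γ) (f v) := by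
  have := hρ.nontrivial
  have : Nontrivial (ConjPair V) := inferInstanceAs (Nontrivial (V × V))
  obtain ⟨S, hS, hτ⟩ := (induced ρ hG hx).exists_irreducible_sub
  refine ⟨S, _, _, _, hτ, ?_⟩
  obtain ⟨v₀, hv₀⟩ := exists_ne (0 : V)
  -- `V` embeds as `(v, 0)` when `S` is everything, and by the inverse of the first projection when
  -- `S` is a graph.
  rcases hρ.inducedBlock_trichotomy hG hx S.toAddSubgroup
    (fun g u hu => hS g u hu) (fun u hu => hS x u hu)
    (starRingEnd ℂ) (starRingEnd ℂ).surjective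
    (fun c v w h => S.smul_mem c h) with hT | hT | ⟨hT, hT', -⟩
  · exfalso
    have := hτ.1
    have h1 : S = ⊥ := Submodule.toAddSubgroup_injective hT
    obtain ⟨v, hv⟩ := exists_ne (0 : S)
    have : (v : ConjPair V) ∈ (⊥ : Submodule ℂ (ConjPair V)) := h1.le v.2
    exact hv (Subtype.ext ((Submodule.mem_bot ℂ).mp this))
  · have h1 : S = ⊤ := Submodule.toAddSubgroup_injective hT
    let f : V →ₗ[ℂ] S :=
      { toFun := fun v => ⟨(v, 0), by rw [h1]; trivial⟩
        map_add' := fun v w => Subtype.ext (Prod.ext rfl (add_zero (0 : V)).symm)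
        map_smul' := fun c v => Subtype.ext (Prod.ext rfl (smul_zero (conj c)).symm) }
    refine ⟨f, fun h => hv₀ ?_, fun g v => Subtype.ext ?_⟩
    · exact congrArg (fun u : S => (u : ConjPair V).1) (LinearMap.congr_fun h v₀)
    · rw [coe_restrict]
      change ((ρ g v, 0) : V × V) = inducedBlock ρ hG hx g (v, 0)
      rw [inducedBlock_coe, map_zero]
  · let p : S →ₗ[ℂ] V :=
      { toFun := fun u => (u : ConjPair V).1
        map_add' := fun _ _ => rfl
        map_smul' := fun _ _ => rfl }
    have hp : ∀ (g : G) u, p (((induced ρ hG hx).restrict S hS).act g u) = ρ g (p u) := by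
      rintro g ⟨⟨v, w⟩, h⟩
      exact congrArg Prod.fst (inducedBlock_coe ρ hG hx g v w)
    have hpb : Function.Bijective p := by
      constructor
      · rw [← LinearMap.ker_eq_bot, LinearMap.ker_eq_bot']
        rintro ⟨⟨v, w⟩, h⟩ (rfl : v = 0)
        exact Subtype.ext (Prod.ext rfl (hT w h))
      · intro v
        obtain ⟨w, hw⟩ := hT' v
        exact ⟨⟨(v, w), hw⟩, rfl⟩
    let e := LinearEquiv.ofBijective p hpb
    have he : ∀ u, e u = p u := fun u => rfl
    refine ⟨e.symm.toLinearMap, fun h => hv₀ ?_, fun g v => ?_⟩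
    · have := LinearMap.congr_fun h v₀
      exact e.symm.injective (this.trans (map_zero e.symm).symm)
    · apply e.injective
      change e (e.symm _) = p (((induced ρ hG hx).restrict S hS).act g (e.symm v))
      rw [hp, LinearEquiv.apply_symm_apply, ← he, LinearEquiv.apply_symm_apply]

section Analysis

variable {V : Type*} [AddCommGroup V] [Module ℂ V] [FiniteDimensional ℂ V]
  {ρ : Representation ℂ G V} {U : Type*} [AddCommGroup U] [Module ℂ U] {τ : AntilinearRep G U}

theorem endAlg_nontrivial (hτ : τ.IsIrreducible) : Nontrivial τ.endAlg := by
  have := hτ.1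
  infer_instance

theorem injective_of_equivariant (hρ : ρ.IsIrreducible) {f : V →ₗ[ℂ] U} (hf0 : f ≠ 0)
    (hf : ∀ (g : G) (v : V), f (ρ g v) = τ.act (g : Γ) (f v)) : Function.Injective f := by
  rw [← LinearMap.ker_eq_bot]
  refine (hρ.eq_bot_or_eq_top (LinearMap.ker f) fun g v hv => ?_).resolve_right
    fun h => hf0 (LinearMap.ker_eq_top.mp h)
  rw [LinearMap.mem_ker] at hv ⊢
  rw [hf, hv, map_zero]

/-- The restriction of `U` to `G` is `V`, so an endomorphism is a complex scalar, and commuting with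
the antilinear action of `x` makes it real. The action of `x` itself is the twisted intertwiner with
square `ρ (x ^ 2)`. -/
theorem endAlg_type_of_surjective [Fintype G] (hG : G.index = 2) {x : Γ} (hx : x ∉ G)
    (hρ : ρ.IsIrreducible) (hτ : τ.IsIrreducible) {f : V →ₗ[ℂ] U} (hf0 : f ≠ 0)
    (hf : ∀ (g : G) (v : V), f (ρ g v) = τ.act (g : Γ) (f v)) (hsurj : Function.Surjective f) :
    IsOfDivType τ.endAlg .real ∧
      twistedIndicator (conjBy hG x) (squareIn hG x) ρ.character = 1 := by
  have := endAlg_nontrivial hτ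
  have := hτ.1
  have hinj := injective_of_equivariant hρ hf0 hf
  let e : V ≃ₗ[ℂ] U := LinearEquiv.ofBijective f ⟨hinj, hsurj⟩
  have he : ∀ v, e v = f v := fun v => rfl
  have hes : ∀ (g : G) u, e.symm (τ.act g u) = ρ g (e.symm u) := fun g u => by
    apply e.injective
    rw [he (ρ g _), hf, ← he, LinearEquiv.apply_symm_apply, LinearEquiv.apply_symm_apply]
  constructor
  · refine isOfDivType_real fun φ => ?_
    obtain ⟨a, ha⟩ := hρ.schur (e.symm.toLinearMap ∘ₗ φ.1 ∘ₗ e.toLinearMap) (fun g v => by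
      simp only [LinearMap.comp_apply, LinearEquiv.coe_coe, he, hf]
      rw [φ.2, hes])
    have ha' : ∀ u, φ.1 u = a • u := by
      intro u
      obtain ⟨v, rfl⟩ := e.surjective u
      have := congrArg e (ha v)
      simpa using this
    obtain ⟨u, hu⟩ := exists_ne (0 : U)
    have hxu : τ.act x u ≠ 0 := fun h => hu (by
      have := congrArg (τ.act x⁻¹) h
      rwa [← Module.End.mul_apply, ← map_mul, inv_mul_cancel, map_one, map_zero] at this)
    have h1 := φ.2 x u
    rw [ha', ha', τ.act_smul_of_notMem x hx] at h1
    have h2 : conj a = a := (smul_left_injective ℂ hxu h1).symm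
    obtain ⟨r, rfl⟩ := Complex.conj_eq_iff_real.mp h2
    refine ⟨r, Subtype.ext (LinearMap.ext fun u => ?_)⟩
    rw [ha', Complex.coe_smul]
    rfl
  · let K : V →ₛₗ[starRingEnd ℂ] V :=
      { toFun := fun v => e.symm (τ.act x (f v))
        map_add' := fun v w => by simp
        map_smul' := fun c v => by rw [map_smul, τ.act_smul_of_notMem x hx, map_smul] }
    have hK : ∀ v, f (K v) = τ.act x (f v) := fun v => e.apply_symm_apply _
    refine (twistedIndicator_eq hρ (K := K) ?_ (Or.inl rfl) fun v => ?_).1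
    · intro g v
      apply hinj
      rw [hK, hf, hf, hK, ← Module.End.mul_apply, ← Module.End.mul_apply, ← map_mul, ← map_mul,
        coe_conjBy, inv_mul_cancel_right]
    · apply hinj
      rw [hK, hK, one_smul, hf, ← Module.End.mul_apply, ← map_mul]
      rfl

/-- Here `U = V ⊕ x⁻¹ V`, and an endomorphism is determined by its values on `V`, where it reads `v
↦ (a • v, N v)` with `a` a scalar and `N` a twisted antilinear intertwiner. So the algebra is ℂ when
every such `N` vanishes and ℍ when there is a `K` with `K ^ 2 = -ρ b`. -/
theorem endAlg_type_of_bijective [Fintype G] (hG : G.index = 2) {x : Γ} (hx : x ∉ G)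
    (hρ : ρ.IsIrreducible) (hτ : τ.IsIrreducible) {f : V →ₗ[ℂ] U}
    (E : (V × V) ≃ₗ[ℝ] U) (hE : ∀ v w, E (v, w) = f v + τ.act x⁻¹ (f w))
    (hEΓ : ∀ (y : Γ) (u : V × V), E (inducedBlock ρ hG hx y u) = τ.act y (E u)) :
    ∃ F, IsOfDivType τ.endAlg F ∧
      twistedIndicator (conjBy hG x) (squareIn hG x) ρ.character = F.sign := by
  have := endAlg_nontrivial hτ
  have := hτ.1
  have := hρ.nontrivial
  obtain ⟨v₀, hv₀⟩ := exists_ne (0 : V)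
  have hx' : x⁻¹ ∉ G := by rwa [inv_mem_iff]
  have hf : ∀ v, f v = E (v, 0) := fun v => by simp [hE]
  have hEs : ∀ (c : ℂ) v w, c • E (v, w) = E (c • v, conj c • w) := fun c v w => by
    rw [hE, hE, map_smul, map_smul, τ.act_smul_of_notMem _ hx', Complex.conj_conj, smul_add]
  have hEsymm : ∀ u, ∃ v w, u = E (v, w) := fun u => ⟨(E.symm u).1, (E.symm u).2, by simp⟩
  have hmk : ∀ Φ : V × V →ₗ[ℝ] V × V,
      (∀ v w, Φ (Complex.I • v, -(Complex.I • w)) =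
        (Complex.I • (Φ (v, w)).1, -(Complex.I • (Φ (v, w)).2))) →
      (∀ (g : G) u, Φ (inducedBlock ρ hG hx g u) = inducedBlock ρ hG hx g (Φ u)) →
      (∀ u, Φ (inducedBlock ρ hG hx x u) = inducedBlock ρ hG hx x (Φ u)) →
      ∃ φ : τ.endAlg, ∀ v w, φ.1 (E (v, w)) = E (Φ (v, w)) := by
    intro Φ h1 h2 h3
    have h4 : ∀ (y : Γ) u, Φ (inducedBlock ρ hG hx y u) = inducedBlock ρ hG hx y (Φ u) := by
      refine forall_of_index_two hG hx h2 h3 fun y z hy hz u => ?_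
      rw [map_mul, Module.End.mul_apply, Module.End.mul_apply, hy, hz]
    have h5 : ∀ u, (E.toLinearMap ∘ₗ Φ ∘ₗ E.symm.toLinearMap) (Complex.I • u) =
        Complex.I • (E.toLinearMap ∘ₗ Φ ∘ₗ E.symm.toLinearMap) u := by
      intro u
      obtain ⟨v, w, rfl⟩ := hEsymm u
      rw [hEs]
      simp only [LinearMap.comp_apply, LinearEquiv.coe_coe, LinearEquiv.symm_apply_apply,
        Complex.conj_I, neg_smul]
      rw [h1, ← Prod.mk.eta (p := Φ (v, w)), hEs, Complex.conj_I, neg_smul]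
    refine ⟨⟨complexLinearOfReal _ h5, fun y u => ?_⟩, fun v w => ?_⟩
    · obtain ⟨u, rfl⟩ := E.surjective u
      simp only [complexLinearOfReal_apply, LinearMap.comp_apply, LinearEquiv.coe_coe,
        LinearEquiv.symm_apply_apply, ← hEΓ, h4]
    · simp [complexLinearOfReal_apply]
  have hext : ∀ φ ψ : τ.endAlg, (∀ v, φ.1 (E (v, 0)) = ψ.1 (E (v, 0))) → φ = ψ := by
    intro φ ψ h
    refine Subtype.ext (LinearMap.ext fun u => ?_)
    obtain ⟨v, w, rfl⟩ := hEsymm u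
    rw [hE, map_add, map_add, φ.2, ψ.2, hf, hf, h, h]
  have hdec : ∀ φ : τ.endAlg, ∃ (a : ℂ) (N : V →ₛₗ[starRingEnd ℂ] V),
      IsTwisted ρ (conjBy hG x) N ∧ ∀ v, φ.1 (E (v, 0)) = E (a • v, N v) := by
    intro φ
    let M : V →ₗ[ℝ] V × V :=
      E.symm.toLinearMap ∘ₗ φ.1.restrictScalars ℝ ∘ₗ E.toLinearMap ∘ₗ LinearMap.inl ℝ V V
    have hM : ∀ v, E (M v) = φ.1 (E (v, 0)) := fun v => by simp [M]
    have hMI : ∀ v, M (Complex.I • v) = (Complex.I • (M v).1, -(Complex.I • (M v).2)) := by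
      intro v
      apply E.injective
      rw [hM, ← neg_smul, ← Complex.conj_I, ← hEs, Prod.mk.eta, hM, ← map_smul, hEs, smul_zero]
    have hMg : ∀ (g : G) v, M (ρ g v) = (ρ g (M v).1, ρ (conjBy hG x g) (M v).2) := by
      intro g v
      apply E.injective
      rw [hM, ← inducedBlock_coe ρ hG hx, hEΓ, Prod.mk.eta, hM, ← φ.2, ← hEΓ, inducedBlock_coe,
        map_zero]
    obtain ⟨a, ha⟩ := hρ.schur (complexLinearOfReal (LinearMap.fst ℝ V V ∘ₗ M)
      fun v => congrArg Prod.fst (hMI v)) (fun g v => congrArg Prod.fst (hMg g v))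
    refine ⟨a, LinearMap.antilinearOfReal (LinearMap.snd ℝ V V ∘ₗ M)
      fun v => congrArg Prod.snd (hMI v), fun g v => congrArg Prod.snd (hMg g v), fun v => ?_⟩
    rw [← ha, ← hM]
    rfl
  -- Scalar multiplication by `I` on `U` is `(I • v, -I • w)` and does not commute with `x`; `(I •
  -- v, I • w)` does, and is complex-linear because the second coordinate carries the conjugate
  -- structure.
  obtain ⟨i, hi⟩ := hmk ((LinearMap.lsmul ℂ (V × V) Complex.I).restrictScalars ℝ)
    (fun v w => by simp) (fun g u => by simp) (fun u => by simp)
  replace hi : ∀ v w, i.1 (E (v, w)) = E (Complex.I • v, Complex.I • w) := hi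
  have hii : i * i = (-1 : ℝ) • (1 : τ.endAlg) := by
    refine hext _ _ fun v => ?_
    change i.1 (i.1 (E (v, 0))) = (-1 : ℝ) • E (v, 0)
    rw [hi, hi, smul_smul, smul_smul, Complex.I_mul_I, ← map_smul]
    simp
  rcases hρ.twisted_trichotomy (conjBy_conjBy hG x) (conjBy_squareIn hG x) with
    hK | ⟨K, hK, hKK⟩ | ⟨K, hK, hKK⟩
  · refine ⟨.complex, isOfDivType_complex i hii fun φ => ?_, (twistedIndicator_eq_zero _ hK).1⟩
    obtain ⟨a, N, hN, h⟩ := hdec φ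
    refine ⟨a.re, a.im, hext _ _ fun v => ?_⟩
    change _ = a.re • E (v, 0) + a.im • i.1 (E (v, 0))
    rw [h, hK N hN, hi, ← map_smul, ← map_smul, ← map_add, Complex.smul_eq_re_add_im]
    simp
  -- If `K ^ 2 = ρ b`, the graph of `K` is a proper nonzero submodule of `U`, contradicting
  -- simplicity.
  · exfalso
    let S : Submodule ℂ U :=
      { carrier := {u | ∃ v, u = E (v, K v)}
        add_mem' := by
          rintro _ _ ⟨v, rfl⟩ ⟨w, rfl⟩
          exact ⟨v + w, by rw [map_add, ← map_add]; rfl⟩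
        zero_mem' := ⟨0, by rw [map_zero]; exact (map_zero E).symm⟩
        smul_mem' := by
          rintro c _ ⟨v, rfl⟩
          exact ⟨c • v, by rw [hEs, map_smulₛₗ]⟩ }
    have hS : ∀ (y : Γ), ∀ u ∈ S, τ.act y u ∈ S := by
      refine forall_of_index_two hG hx ?_ ?_ ?_
      · rintro g _ ⟨v, rfl⟩
        exact ⟨ρ g v, by rw [← hEΓ, inducedBlock_coe, hK]⟩
      · rintro _ ⟨v, rfl⟩
        exact ⟨K v, by rw [← hEΓ, inducedBlock_self, hKK]⟩
      · intro y z hy hz u hu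
        rw [map_mul]
        exact hy _ (hz _ hu)
    rcases hτ.2 S hS with h | h
    · have : E (v₀, K v₀) ∈ S := ⟨v₀, rfl⟩
      rw [h, Submodule.mem_bot] at this
      exact hv₀ (congrArg Prod.fst (E.injective (this.trans (map_zero E).symm)))
    · have : E (0, v₀) ∈ S := by rw [h]; trivial
      obtain ⟨v, hv⟩ := this
      obtain ⟨rfl, h2⟩ := Prod.mk.inj (E.injective hv)
      rw [map_zero] at h2
      exact hv₀ h2
  · let b := squareIn hG x
    let K' : V →ₗ[ℝ] V := LinearMap.realOfAntilinear K
    let R : V →ₗ[ℝ] V := (ρ b⁻¹).restrictScalars ℝ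
    -- On `V` the map `j` is `v ↦ (0, K v)`; commuting with `x` then forces the value `ρ b⁻¹ (K w)`
    -- on the other summand.
    obtain ⟨j, hj⟩ := hmk ((R ∘ₗ K' ∘ₗ LinearMap.snd ℝ V V).prod (K' ∘ₗ LinearMap.fst ℝ V V))
      (fun v w => by simp [R, K'])
      (fun g ⟨v, w⟩ => by
        rw [inducedBlock_coe]
        change (ρ b⁻¹ (K (ρ _ w)), K (ρ g v)) = inducedBlock ρ hG hx g (ρ b⁻¹ (K w), K v)
        rw [inducedBlock_coe, hK, hK, conjBy_conjBy, ← Module.End.mul_apply, ← map_mul,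
          ← Module.End.mul_apply (ρ g), ← map_mul]
        simp [b, mul_assoc])
      (fun ⟨v, w⟩ => by
        rw [inducedBlock_self]
        change (ρ b⁻¹ (K (ρ b v)), K w) = inducedBlock ρ hG hx x (ρ b⁻¹ (K w), K v)
        rw [inducedBlock_self, hK, conjBy_squareIn, ← Module.End.mul_apply, ← map_mul,
          ← Module.End.mul_apply, ← map_mul, inv_mul_cancel, mul_inv_cancel, map_one]
        rfl)
    replace hj : ∀ v w, j.1 (E (v, w)) = E (ρ b⁻¹ (K w), K v) := hj
    refine ⟨.quaternion, isOfDivType_quaternion i j hii ?_ ?_ fun φ => ?_, ?_⟩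
    · refine hext _ _ fun v => ?_
      change j.1 (j.1 (E (v, 0))) = (-1 : ℝ) • E (v, 0)
      rw [hj, hj, hKK, map_zero, map_zero, map_zero, ← map_smul, map_neg, ← Module.End.mul_apply,
        ← map_mul, inv_mul_cancel, map_one]
      simp
    · refine hext _ _ fun v => ?_
      change j.1 (i.1 (E (v, 0))) = (-1 : ℝ) • i.1 (j.1 (E (v, 0)))
      rw [hi, hj, hj, hi, ← map_smul, antilinear_I]
      simp
    · obtain ⟨a, N, hN, h⟩ := hdec φ
      obtain ⟨d, hd⟩ := hρ.twisted_eq_smul (conjBy_conjBy hG x) (conjBy_squareIn hG x) hK hN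
        (neg_ne_zero.mpr (one_ne_zero (α := ℂ))) (fun v => by rw [hKK, neg_one_smul])
      refine ⟨a.re, a.im, d.re, d.im, hext _ _ fun v => ?_⟩
      change _ = a.re • E (v, 0) + a.im • i.1 (E (v, 0)) + d.re • j.1 (E (v, 0)) +
        d.im • i.1 (j.1 (E (v, 0)))
      rw [h, hd, hj, hi, hi, ← map_smul E, ← map_smul E, ← map_smul E, ← map_smul E, ← map_add, ← map_add,
        ← map_add, Complex.smul_eq_re_add_im, Complex.smul_eq_re_add_im d]
      simp
    · exact (twistedIndicator_eq hρ hK (Or.inr rfl) (fun v => by rw [hKK, neg_one_smul])).1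

/-- The map `(v, w) ↦ f v + x⁻¹ f w` is onto by simplicity. Its kernel decides between the two
preceding lemmas: zero gives `U = V ⊕ x⁻¹ V`, and a graph makes `f` itself surjective. -/
theorem endAlg_type [Fintype G] (hG : G.index = 2) {x : Γ} (hx : x ∉ G)
    (hρ : ρ.IsIrreducible) (hτ : τ.IsIrreducible) {f : V →ₗ[ℂ] U} (hf0 : f ≠ 0)
    (hf : ∀ (g : G) (v : V), f (ρ g v) = τ.act (g : Γ) (f v)) :
    ∃ F, IsOfDivType τ.endAlg F ∧
      twistedIndicator (conjBy hG x) (squareIn hG x) ρ.character = F.sign := by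
  have := hρ.nontrivial
  have hfinj := injective_of_equivariant hρ hf0 hf
  have hx' : x⁻¹ ∉ G := by rwa [inv_mem_iff]
  let E : V × V →ₗ[ℝ] U :=
    (f.restrictScalars ℝ).coprod (τ.act x⁻¹ ∘ₗ f.restrictScalars ℝ)
  have hE : ∀ v w, E (v, w) = f v + τ.act x⁻¹ (f w) := fun v w => by simp [E]
  have hEs : ∀ (c : ℂ) v w, c • E (v, w) = E (c • v, conj c • w) := fun c v w => by
    rw [hE, hE, map_smul, map_smul, τ.act_smul_of_notMem _ hx', Complex.conj_conj, smul_add]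
  have hEΓ : ∀ (y : Γ) (u : V × V), E (inducedBlock ρ hG hx y u) = τ.act y (E u) := by
    refine forall_of_index_two hG hx ?_ ?_ ?_
    · rintro g ⟨v, w⟩
      rw [inducedBlock_coe, hE, hE, map_add, hf, hf, coe_conjBy, ← Module.End.mul_apply,
        ← Module.End.mul_apply, ← map_mul, ← map_mul,
        show x⁻¹ * (x * (g : Γ) * x⁻¹) = g * x⁻¹ by group]
    · rintro ⟨v, w⟩
      rw [inducedBlock_self, hE, hE, map_add, hf, ← Module.End.mul_apply,
        ← Module.End.mul_apply, ← map_mul, ← map_mul, mul_inv_cancel, map_one]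
      simp [squareIn, add_comm]
    · intro y z hy hz u
      rw [map_mul, Module.End.mul_apply, hy, hz, map_mul, Module.End.mul_apply]
  obtain ⟨v₀, hv₀⟩ := exists_ne (0 : V)
  have hfv₀ : f v₀ ≠ 0 := fun h => hv₀ (hfinj (h.trans (map_zero f).symm))
  have hEsurj : Function.Surjective E := by
    let S : Submodule ℂ U :=
      { carrier := {u | u ∈ LinearMap.range E}
        add_mem' := fun {a b} ha hb => (LinearMap.range E).add_mem ha hb
        zero_mem' := zero_mem (LinearMap.range E)
        smul_mem' := by
          rintro c _ ⟨⟨v, w⟩, rfl⟩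
          exact ⟨_, (hEs c v w).symm⟩ }
    have hS : S = ⊤ := by
      refine (hτ.2 S ?_).resolve_left fun h => hfv₀ ?_
      · rintro y _ ⟨u, rfl⟩
        exact ⟨_, hEΓ y u⟩
      · have : f v₀ ∈ S := ⟨(v₀, 0), by simp [hE]⟩
        rwa [h, Submodule.mem_bot] at this
    intro u
    have : u ∈ S := by rw [hS]; trivial
    exact this
  have hT := hρ.inducedBlock_trichotomy hG hx (LinearMap.ker E).toAddSubgroup
    (fun g u hu => by
      have hu : E u = 0 := hu
      change E _ = 0
      rw [hEΓ, hu, map_zero])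
    (fun u hu => by
      have hu : E u = 0 := hu
      change E _ = 0
      rw [hEΓ, hu, map_zero])
    (starRingEnd ℂ) (starRingEnd ℂ).surjective
    (fun c v w h => by
      have h : E (v, w) = 0 := h
      change E _ = 0
      rw [← hEs, h, smul_zero])
  rcases hT with hT | hT | ⟨-, -, hT⟩
  · have hEinj : Function.Injective E := by
      rw [← LinearMap.ker_eq_bot]
      exact Submodule.toAddSubgroup_injective hT
    exact endAlg_type_of_bijective hG hx hρ hτ (LinearEquiv.ofBijective E ⟨hEinj, hEsurj⟩) hE hEΓ
  · exfalso
    have : ((v₀, 0) : V × V) ∈ (LinearMap.ker E).toAddSubgroup := by rw [hT]; trivial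
    have : E (v₀, 0) = 0 := this
    rw [hE] at this
    exact hfv₀ (by simpa using this)
  · refine ⟨.real, endAlg_type_of_surjective hG hx hρ hτ hf0 hf fun u => ?_⟩
    obtain ⟨⟨v, w⟩, rfl⟩ := hEsurj u
    obtain ⟨v', hv'⟩ := hT w
    have hv' : E (v', w) = 0 := hv'
    refine ⟨v - v', ?_⟩
    rw [hE] at hv' ⊢
    rw [map_sub, eq_neg_of_add_eq_zero_left hv', sub_neg_eq_add]

end Analysis

end AntilinearRep

theorem hasRealType_iff {Γ : Type*} [Group Γ] {G : Subgroup Γ} [Fintype G] (hG : G.index = 2)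
    {x : Γ} (hx : x ∉ G) (χ : G → ℂ) (F : DivType) :
    HasRealType G χ F ↔
      IsIrrChar χ ∧ twistedIndicator (conjBy hG x) (squareIn hG x) χ = F.sign := by
  constructor
  · rintro ⟨V, _, _, ρ, ⟨hV, hρ, rfl⟩, U, _, _, τ, hτ, ⟨f, hf0, hf⟩, hF⟩
    obtain ⟨F', h1, h2⟩ := AntilinearRep.endAlg_type hG hx hρ hτ hf0 hf
    exact ⟨.of_rep hρ, by rw [h2, h1.unique hF]⟩
  · rintro ⟨⟨V, _, _, ρ, hV, hρ, rfl⟩, hF⟩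
    obtain ⟨U, _, _, τ, hτ, f, hf0, hf⟩ := AntilinearRep.exists_irreducible_of_rep hρ hG hx
    obtain ⟨F', h1, h2⟩ := AntilinearRep.endAlg_type hG hx hρ hτ hf0 hf
    refine ⟨V, _, _, ρ, ⟨hV, hρ, rfl⟩, U, _, _, τ, hτ, ⟨f, hf0, hf⟩, ?_⟩
    rwa [← DivType.sign_injective (h2.symm.trans hF)]

theorem Set.ncard_eq_two_mul_of_fibers {α β : Type*} {A : Set α} {B : Set β} (f : α → β)
    (hA : A.Finite) (hB : B.Finite) (hf : ∀ a ∈ A, f a ∈ B)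
    (h : ∀ b ∈ B, {a | a ∈ A ∧ f a = b}.ncard = 2) : A.ncard = 2 * B.ncard := by
  classical
  lift A to Finset α using hA
  lift B to Finset β using hB
  rw [Set.ncard_coe_finset, Set.ncard_coe_finset,
    Finset.card_eq_sum_card_fiberwise (f := f) (t := B) hf]
  rw [Finset.sum_const_nat (m := 2), mul_comm]
  intro b hb
  rw [← h b hb, ← Set.ncard_coe_finset]
  congr 1
  ext a
  simp

/-! ### Indicators and pairings on `Γ` in terms of `G` -/

section Sums

variable {Γ : Type*} [Group Γ] [Fintype Γ] {G : Subgroup Γ} [Fintype G] (hG : G.index = 2)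
  {x : Γ} (hx : x ∉ G)

include hG in
theorem natCard_eq_two_mul : (Nat.card Γ : ℂ) = 2 * Nat.card G := by
  rw [← G.card_mul_index, hG]
  push_cast
  ring

include hG hx in
theorem sum_eq_sum_add_sum_coset (F : Γ → ℂ) :
    ∑ y, F y = ∑ g : G, F g + ∑ g : G, F (x * g) := by
  classical
  rw [← Fintype.sum_subtype_add_sum_subtype (· ∈ G) F]
  congr 1
  · convert rfl
  · symm
    refine Fintype.sum_bijective (fun g : G => (⟨x * g, by
      rwa [Subgroup.mul_mem_cancel_right G g.2]⟩ : {y // y ∉ G})) ⟨?_, ?_⟩ _ _ fun g => rfl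
    · intro g h hgh
      exact Subtype.ext (mul_left_cancel (congrArg Subtype.val hgh))
    · rintro ⟨y, hy⟩
      obtain ⟨g, rfl⟩ := exists_eq_mul_of_notMem hG hx hy
      exact ⟨g, rfl⟩

-- The sum over `G` gives the classical indicator. The sum over `xG` gives the twisted one, because
-- `(x * g) ^ 2` is `conjBy x g * x ^ 2 * g`.
include hx in
theorem twistedIndicator_eq_of_index_two (ψ : Γ → ℂ) :
    twistedIndicator (MonoidHom.id Γ) 1 ψ =
      (twistedIndicator (MonoidHom.id G) 1 (fun g => ψ g) +
        twistedIndicator (conjBy hG x) (squareIn hG x) (fun g : G => ψ g)) / 2 := by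
  have hc : (Nat.card G : ℂ) ≠ 0 := by simp
  simp only [twistedIndicator]
  rw [sum_eq_sum_add_sum_coset hG hx, natCard_eq_two_mul hG]
  have h : ∀ g : G, (MonoidHom.id Γ (x * g)) * 1 * (x * g) =
      ((conjBy hG x g * squareIn hG x * g : G) : Γ) := fun g => by
    simp [squareIn, mul_assoc]
  simp only [h]
  field_simp
  rfl

theorem twistedIndicator_add (α : G →* G) (b : G) (χ φ : G → ℂ) :
    twistedIndicator α b (χ + φ) = twistedIndicator α b χ + twistedIndicator α b φ := by
  simp [twistedIndicator, Finset.sum_add_distrib, mul_add]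

theorem conjBy_bijective (x : Γ) : Function.Bijective (conjBy hG x) :=
  haveI := Subgroup.normal_of_index_eq_two hG
  (MulAut.conjNormal x).bijective

theorem twistedIndicator_id_comp_conjBy (χ : G → ℂ) :
    twistedIndicator (MonoidHom.id G) 1 (fun g => χ (conjBy hG x g)) =
      twistedIndicator (MonoidHom.id G) 1 χ := by
  simp only [twistedIndicator]
  congr 1
  exact Fintype.sum_bijective _ (conjBy_bijective hG x) _ _ fun g => by simp

theorem twistedIndicator_conjBy_comp_conjBy (χ : G → ℂ) :
    twistedIndicator (conjBy hG x) (squareIn hG x) (fun g => χ (conjBy hG x g)) =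
      twistedIndicator (conjBy hG x) (squareIn hG x) χ := by
  simp only [twistedIndicator]
  congr 1
  exact Fintype.sum_bijective _ (conjBy_bijective hG x) _ _ fun g => by
    rw [map_mul, map_mul, conjBy_squareIn]

theorem restrict_inducedChar (χ : G → ℂ) :
    (fun g : G => inducedChar hG x χ g) = χ + fun g => χ (conjBy hG x g) :=
  funext fun g => inducedChar_coe hG χ g

include hx in
theorem twistedIndicator_inducedChar (χ : G → ℂ) :
    twistedIndicator (MonoidHom.id Γ) 1 (inducedChar hG x χ) =
      twistedIndicator (MonoidHom.id G) 1 χ +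
        twistedIndicator (conjBy hG x) (squareIn hG x) χ := by
  rw [twistedIndicator_eq_of_index_two hG hx, restrict_inducedChar, twistedIndicator_add,
    twistedIndicator_add, twistedIndicator_id_comp_conjBy, twistedIndicator_conjBy_comp_conjBy]
  ring

include hG in
theorem charPairing_of_vanish {ψ φ : Γ → ℂ} (h : ∀ y ∉ G, φ y = 0) :
    charPairing ψ φ = charPairing (fun g : G => ψ g) (fun g => φ g) / 2 := by
  obtain ⟨x, hx⟩ : ∃ x, x ∉ G := by
    by_contra! hc
    have : G = ⊤ := by rw [eq_top_iff]; exact fun y _ => hc y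
    rw [this, Subgroup.index_top] at hG
    omega
  have hc : (Nat.card G : ℂ) ≠ 0 := by simp
  have h0 : ∀ g : G, φ (x * g)⁻¹ = 0 := fun g => h _ (by
    rwa [inv_mem_iff, Subgroup.mul_mem_cancel_right G g.2])
  simp only [charPairing]
  rw [sum_eq_sum_add_sum_coset hG hx, natCard_eq_two_mul hG]
  simp only [h0, mul_zero, Finset.sum_const_zero, add_zero]
  field_simp
  rfl

end Sums

/-! ### Twisting by the sign character of `Γ / G` -/

section SignTwist

variable {Γ : Type*} [Group Γ] {G : Subgroup Γ}

open Classical in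
/-- The sign character of `Γ` with kernel `G`. -/
noncomputable def cosetSign (G : Subgroup Γ) (y : Γ) : ℂ := if y ∈ G then 1 else -1

theorem cosetSign_mul (hG : G.index = 2) (y z : Γ) :
    cosetSign G (y * z) = cosetSign G y * cosetSign G z := by
  have hm := Subgroup.mul_mem_iff_of_index_two hG (a := y) (b := z)
  by_cases hy : y ∈ G <;> by_cases hz : z ∈ G <;> simp only [hy, hz, iff_true, iff_false,
    not_true] at hm <;> simp [cosetSign, hm, hy, hz]

theorem cosetSign_ne_zero (y : Γ) : cosetSign G y ≠ 0 := by
  rw [cosetSign]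
  split_ifs <;> simp

theorem IsIrrChar.sign_mul (hG : G.index = 2) {ψ : Γ → ℂ} (hψ : IsIrrChar ψ) :
    IsIrrChar (fun y => cosetSign G y * ψ y) := by
  obtain ⟨U, _, _, τ, hU, hτ, rfl⟩ := hψ
  let τ' : Representation ℂ Γ U :=
    { toFun := fun y => cosetSign G y • τ y
      map_one' := by simp [cosetSign, one_mem]
      map_mul' := fun y z => by
        rw [cosetSign_mul hG, map_mul, smul_mul_smul_comm] }
  have := hτ.nontrivial
  have hτ' : τ'.IsIrreducible := Representation.IsIrreducible.of_forall fun S hS =>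
    hτ.eq_bot_or_eq_top S fun y u hu => by
      have h1 := S.smul_mem (cosetSign G y)⁻¹ (hS y u hu)
      change (cosetSign G y)⁻¹ • cosetSign G y • τ y u ∈ S at h1
      rwa [smul_smul, inv_mul_cancel₀ (cosetSign_ne_zero y), one_smul] at h1
  have h : (fun y => cosetSign G y * τ.character y) = τ'.character := by
    funext y
    change _ = LinearMap.trace ℂ U (cosetSign G y • τ y)
    rw [map_smul]
    rfl
  rw [h]
  exact .of_rep hτ'

end SignTwist

/-! ### Counting extensions and induced characters -/

section CliffordCounting

variable {Γ : Type*} [Group Γ] [Fintype Γ] {G : Subgroup Γ} [Fintype G] (hG : G.index = 2)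
  {x : Γ} (hx : x ∉ G)

theorem IsIrrChar.comp_conjBy {χ : G → ℂ} (hχ : IsIrrChar χ) :
    IsIrrChar (fun g => χ (conjBy hG x g)) :=
  hχ.comp_surjective _ (conjBy_surjective hG x)

theorem IsIrrChar.conjBy_conjBy_apply {χ : G → ℂ} (hχ : IsIrrChar χ) (g : G) :
    χ (conjBy hG x (conjBy hG x g)) = χ g := by
  rw [conjBy_conjBy, hχ.conj_apply]

/-- If `χ` were invariant, the induced character would restrict to `2χ` and have norm `4 / 2 = 2`.
-/
theorem IsIrrChar.ne_of_inducedChar {χ : G → ℂ} (hχ : IsIrrChar χ)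
    (h : IsIrrChar (inducedChar hG x χ)) : (fun g => χ (conjBy hG x g)) ≠ χ := by
  intro he
  have h1 := h.pairing_self
  rw [charPairing_of_vanish hG (fun y hy => inducedChar_of_notMem hG χ hy), restrict_inducedChar,
    he, charPairing_add_left, charPairing_add_right, hχ.pairing_self] at h1
  norm_num at h1

-- Otherwise `χ` would extend to `Γ`, and the restriction of a class function of `Γ` is invariant
-- under conjugation by `x`.
include hx in
theorem IsIrrChar.inducedChar {χ : G → ℂ} (hχ : IsIrrChar χ)
    (h : (fun g => χ (conjBy hG x g)) ≠ χ) : IsIrrChar (inducedChar hG x χ) := by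
  refine (hχ.extends_or_induces hG hx).resolve_left ?_
  rintro ⟨ψ, hψ, hψχ⟩
  refine h (funext fun g => ?_)
  rw [← hψχ, ← hψχ, coe_conjBy, hψ.conj_apply]

include hx in
theorem IsIrrChar.exists_extension {χ : G → ℂ} (hχ : IsIrrChar χ)
    (h : (fun g => χ (conjBy hG x g)) = χ) :
    ∃ ψ : Γ → ℂ, IsIrrChar ψ ∧ (fun g : G => ψ g) = χ := by
  rcases hχ.extends_or_induces hG hx with ⟨ψ, hψ, hψχ⟩ | h'
  · exact ⟨ψ, hψ, funext hψχ⟩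
  · exact absurd h (hχ.ne_of_inducedChar hG h')

theorem IsIrrChar.not_isIrrChar_restrict_inducedChar {χ : G → ℂ} (hχ : IsIrrChar χ)
    (h : (fun g => χ (conjBy hG x g)) ≠ χ) :
    ¬ IsIrrChar (fun g : G => _root_.inducedChar hG x χ g) := by
  intro h'
  have h1 := h'.pairing_self
  rw [restrict_inducedChar, charPairing_add_left, charPairing_add_right, charPairing_add_right,
    hχ.pairing_self, (hχ.comp_conjBy hG).pairing_self, hχ.pairing_of_ne (hχ.comp_conjBy hG) h.symm,
    (hχ.comp_conjBy hG).pairing_of_ne hχ h] at h1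
  norm_num at h1

theorem inducedChar_comp_conjBy {χ : G → ℂ} (hχ : IsIrrChar χ) :
    inducedChar hG x (fun g => χ (conjBy hG x g)) = inducedChar hG x χ := by
  funext y
  by_cases hy : y ∈ G
  · lift y to G using hy
    rw [inducedChar_coe, inducedChar_coe, hχ.conjBy_conjBy_apply hG, add_comm]
  · rw [inducedChar_of_notMem _ _ hy, inducedChar_of_notMem _ _ hy]

/-- Restricted to `G`, the hypothesis reads `φ + φ^x = χ + χ^x`; pairing with `φ` gives `1 = 0`
unless `φ` occurs on the right. -/
theorem IsIrrChar.eq_of_inducedChar_eq {χ φ : G → ℂ} (hχ : IsIrrChar χ) (hφ : IsIrrChar φ)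
    (hφx : (fun g => φ (conjBy hG x g)) ≠ φ)
    (h : _root_.inducedChar hG x φ = _root_.inducedChar hG x χ) :
    φ = χ ∨ φ = fun g => χ (conjBy hG x g) := by
  by_contra! hc
  have h1 := congrArg (fun ψ : Γ → ℂ => charPairing (fun g : G => ψ g) φ) h
  simp only [restrict_inducedChar, charPairing_add_left] at h1
  rw [hφ.pairing_self, (hφ.comp_conjBy hG).pairing_of_ne hφ hφx, hχ.pairing_of_ne hφ hc.1.symm,
    (hχ.comp_conjBy hG).pairing_of_ne hφ hc.2.symm] at h1
  norm_num at h1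

theorem restrict_sign_mul (ψ : Γ → ℂ) :
    (fun g : G => cosetSign G g * ψ g) = fun g : G => ψ g := by
  funext g
  simp [cosetSign]

-- A character equal to its sign twist vanishes off `G`; with irreducible restriction its norm would
-- be `1 / 2`.
include hG in
theorem IsIrrChar.sign_mul_ne {ψ : Γ → ℂ} (hψ : IsIrrChar ψ)
    (hres : IsIrrChar (fun g : G => ψ g)) : (fun y => cosetSign G y * ψ y) ≠ ψ := by
  intro h
  have h0 : ∀ y ∉ G, ψ y = 0 := fun y hy => by
    have := congrFun h y
    simp only [cosetSign, if_neg hy] at this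
    linear_combination (-1 / 2 : ℂ) * this
  have h1 := hψ.pairing_self
  rw [charPairing_of_vanish hG h0, hres.pairing_self] at h1
  norm_num at h1

-- The sum of `ψ` and its sign twist vanishes off `G` and is `2ψ` on `G`, so its pairing with `φ` is
-- `1`. Hence `φ` cannot be orthogonal to both summands.
include hG in
theorem IsIrrChar.eq_or_eq_sign_mul {ψ φ : Γ → ℂ} (hψ : IsIrrChar ψ) (hφ : IsIrrChar φ)
    (hres : IsIrrChar (fun g : G => ψ g)) (h : (fun g : G => φ g) = fun g : G => ψ g) :
    φ = ψ ∨ φ = fun y => cosetSign G y * ψ y := by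
  by_contra! hc
  have h0 : ∀ y ∉ G, (ψ + fun y => cosetSign G y * ψ y) y = 0 := fun y hy => by
    simp [cosetSign, hy]
  have h1 : (fun g : G => (ψ + fun y => cosetSign G y * ψ y) g) =
      (fun g : G => ψ g) + fun g : G => ψ g := by
    funext g
    simp [cosetSign]
  have h2 := charPairing_of_vanish hG (ψ := φ) h0
  rw [charPairing_add_right, hφ.pairing_of_ne hψ hc.1, hφ.pairing_of_ne (hψ.sign_mul hG) hc.2, h1, h,
    charPairing_add_right, hres.pairing_self] at h2
  norm_num at h2

include hx in
/-- The number of irreducible characters of `Γ` of a given type in terms of the irreducible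
characters of `G`. -/
theorem charCount_eq (F : DivType) : (charCount Γ F : ℚ) =
    2 * ({χ : G → ℂ | IsIrrChar χ ∧ (fun g => χ (conjBy hG x g)) = χ ∧
      twistedIndicator (MonoidHom.id G) 1 χ +
        twistedIndicator (conjBy hG x) (squareIn hG x) χ = 2 * F.sign}.ncard : ℚ) +
    1 / 2 * ({χ : G → ℂ | IsIrrChar χ ∧ (fun g => χ (conjBy hG x g)) ≠ χ ∧
      twistedIndicator (MonoidHom.id G) 1 χ +
        twistedIndicator (conjBy hG x) (squareIn hG x) χ = F.sign}.ncard : ℚ) := by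
  set B₁ := {χ : G → ℂ | IsIrrChar χ ∧ (fun g => χ (conjBy hG x g)) = χ ∧
      twistedIndicator (MonoidHom.id G) 1 χ +
        twistedIndicator (conjBy hG x) (squareIn hG x) χ = 2 * F.sign}
  set B₂ := {χ : G → ℂ | IsIrrChar χ ∧ (fun g => χ (conjBy hG x g)) ≠ χ ∧
      twistedIndicator (MonoidHom.id G) 1 χ +
        twistedIndicator (conjBy hG x) (squareIn hG x) χ = F.sign}
  let A := {ψ : Γ → ℂ | HasCharType ψ F}
  let A₁ := {ψ : Γ → ℂ | HasCharType ψ F ∧ IsIrrChar (fun g : G => ψ g)}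
  let A₂ := {ψ : Γ → ℂ | HasCharType ψ F ∧ ¬ IsIrrChar (fun g : G => ψ g)}
  have hfinA : A.Finite := finite_setOf_isIrrChar.subset fun ψ hψ => ((hasCharType_iff ψ F).mp hψ).1
  have hfinA₁ : A₁.Finite := hfinA.subset fun ψ hψ => hψ.1
  have hfinA₂ : A₂.Finite := hfinA.subset fun ψ hψ => hψ.1
  have hfinB₁ : B₁.Finite := finite_setOf_isIrrChar.subset fun χ hχ => hχ.1
  have hfinB₂ : B₂.Finite := finite_setOf_isIrrChar.subset fun χ hχ => hχ.1
  have hA : A.ncard = A₁.ncard + A₂.ncard := by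
    rw [← Set.ncard_union_eq _ hfinA₁ hfinA₂]
    · congr 1
      ext ψ
      simp only [A, A₁, A₂, Set.mem_union, Set.mem_ofPred_eq]
      tauto
    · rw [Set.disjoint_left]
      exact fun ψ h h' => h'.2 h.2
  -- Restriction is two-to-one here: the fibre over `χ` consists of an extension and its sign twist.
  have h₁ : A₁.ncard = 2 * B₁.ncard := by
    refine Set.ncard_eq_two_mul_of_fibers (fun ψ g => ψ g) hfinA₁ hfinB₁ ?_ ?_
    · rintro ψ ⟨hψ, hres⟩
      rw [hasCharType_iff, twistedIndicator_eq_of_index_two hG hx] at hψ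
      refine ⟨hres, funext fun g => ?_, by rw [← hψ.2]; ring⟩
      change ψ (conjBy hG x g) = _
      rw [coe_conjBy, hψ.1.conj_apply]
    · rintro χ ⟨hχ, hχx, hχF⟩
      obtain ⟨ψ, hψ, rfl⟩ := hχ.exists_extension hG hx hχx
      rw [Set.ncard_eq_two]
      refine ⟨ψ, fun y => cosetSign G y * ψ y, (hψ.sign_mul_ne hG hχ).symm, ?_⟩
      ext φ
      simp only [Set.mem_ofPred_eq, Set.mem_insert_iff, Set.mem_singleton_iff]
      constructor
      · rintro ⟨⟨h1, -⟩, h2⟩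
        exact hψ.eq_or_eq_sign_mul hG ((hasCharType_iff _ _).mp h1).1 hχ h2
      · have key : ∀ φ : Γ → ℂ, IsIrrChar φ → ((fun g : G => φ g) = fun g : G => ψ g) →
            φ ∈ A₁ ∧ (fun g : G => φ g) = fun g : G => ψ g := by
          intro φ hφ h
          refine ⟨⟨(hasCharType_iff _ _).mpr ⟨hφ, ?_⟩, by rwa [h]⟩, h⟩
          rw [twistedIndicator_eq_of_index_two hG hx, h, hχF]
          ring
        rintro (rfl | rfl)
        · exact key _ hψ rfl
        · exact key _ (hψ.sign_mul hG) (restrict_sign_mul ψ)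
  -- Induction goes the other way and is again two-to-one, with fibres `{χ, χ^x}`; this is the
  -- source of the factor `1 / 2`.
  have h₂ : B₂.ncard = 2 * A₂.ncard := by
    refine Set.ncard_eq_two_mul_of_fibers (inducedChar hG x) hfinB₂ hfinA₂ ?_ ?_
    · rintro χ ⟨hχ, hχx, hχF⟩
      refine ⟨(hasCharType_iff _ _).mpr ⟨hχ.inducedChar hG hx hχx, ?_⟩,
        hχ.not_isIrrChar_restrict_inducedChar hG hχx⟩
      rw [twistedIndicator_inducedChar hG hx, hχF]
    · rintro ψ ⟨hψ, hres⟩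
      rw [hasCharType_iff] at hψ
      obtain ⟨χ, hχ, rfl⟩ := (hψ.1.restrict_or_induced hG hx).resolve_left hres
      have hχx := hχ.ne_of_inducedChar hG hψ.1
      have hF := hψ.2
      rw [twistedIndicator_inducedChar hG hx] at hF
      rw [Set.ncard_eq_two]
      refine ⟨χ, fun g => χ (conjBy hG x g), hχx.symm, ?_⟩
      ext φ
      simp only [Set.mem_ofPred_eq, Set.mem_insert_iff, Set.mem_singleton_iff]
      constructor
      · rintro ⟨⟨h1, h2, -⟩, h3⟩
        exact hχ.eq_of_inducedChar_eq hG h1 h2 h3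
      · rintro (rfl | rfl)
        · exact ⟨⟨hχ, hχx, hF⟩, rfl⟩
        · refine ⟨⟨hχ.comp_conjBy hG, fun h => hχx ?_, ?_⟩, inducedChar_comp_conjBy hG hχ⟩
          · funext g
            have := congrFun h g
            simp only [hχ.conjBy_conjBy_apply hG] at this
            exact this.symm
          · rw [twistedIndicator_id_comp_conjBy, twistedIndicator_conjBy_comp_conjBy, hF]
  have h₂' : (B₂.ncard : ℚ) = 2 * A₂.ncard := by exact_mod_cast h₂
  change (A.ncard : ℚ) = _
  rw [hA, h₁, h₂']
  push_cast
  ring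

end CliffordCounting

/-! ### Dyson types in terms of the two indicators -/

section Dyson

variable {Γ : Type*} [Group Γ] {G : Subgroup Γ} (hG : G.index = 2) {x : Γ} (hx : x ∉ G)

/-- The indicator of an irreducible character takes the values `1`, `0`, `-1`, and it is nonzero
exactly when the twist of the character is its complex conjugate. -/
theorem IsIrrChar.twistedIndicator_eq_sign {H : Type*} [Group H] [Fintype H] {α : H →* H} {b : H}
    (hα : ∀ g, α (α g) = b * g * b⁻¹) (hb : α b = b) {χ : H → ℂ} (hχ : IsIrrChar χ) :
    ∃ F : DivType, twistedIndicator α b χ = F.sign ∧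
      ((fun g => conj (χ g)) = (fun g => χ (α g)) ↔ F ≠ .complex) := by
  obtain ⟨V, _, _, ρ, hV, hρ, rfl⟩ := hχ
  have := hρ.nontrivial
  rcases hρ.twisted_trichotomy hα hb with hK | ⟨K, hK, hKK⟩ | ⟨K, hK, hKK⟩
  · obtain ⟨h1, h2⟩ := twistedIndicator_eq_zero b hK
    refine ⟨.complex, h1, iff_of_false (fun h => ?_) (by simp)⟩
    -- If the twist were the complex conjugate, the vanishing sum of `χ (α g) * χ g` would be the
    -- sum of `|χ g| ^ 2`, although `χ 1` is the nonzero dimension.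
    have h3 : ∑ g, Complex.normSq (ρ.character g) = 0 := by
      have : ((∑ g, Complex.normSq (ρ.character g) : ℝ) : ℂ) = 0 := by
        rw [← h2, Complex.ofReal_sum]
        refine Finset.sum_congr rfl fun g _ => ?_
        rw [← congrFun h g, Complex.normSq_eq_conj_mul_self]
      exact_mod_cast this
    rw [Finset.sum_eq_zero_iff_of_nonneg fun g _ => Complex.normSq_nonneg _] at h3
    have h4 := h3 1 (Finset.mem_univ _)
    rw [Complex.normSq_eq_zero, Representation.char_one, Nat.cast_eq_zero] at h4
    exact Module.finrank_pos.ne' h4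
  · obtain ⟨h1, h2⟩ := twistedIndicator_eq hρ hK (Or.inl rfl) (fun v => by rw [hKK, one_smul])
    exact ⟨.real, h1, iff_of_true (funext fun g => (h2 g).symm) (by simp)⟩
  · obtain ⟨h1, h2⟩ := twistedIndicator_eq hρ hK (Or.inr rfl) (fun v => by rw [hKK, neg_one_smul])
    exact ⟨.quaternion, h1, iff_of_true (funext fun g => (h2 g).symm) (by simp)⟩

include hx in
theorem kleinOrbit_eq {χ : G → ℂ} (hχ : IsIrrChar χ) :
    kleinOrbit hG χ = {χ, fun g => conj (χ g), fun g => χ (conjBy hG x g),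
      fun g => conj (χ (conjBy hG x g))} := by
  -- Any `y ∉ G` differs from `x` by an element of `G`, whose inner action does not affect a class
  -- function.
  have key : ∀ y ∉ G, conjChar hG y χ = fun g => χ (conjBy hG x g) := by
    intro y hy
    obtain ⟨h, rfl⟩ := exists_eq_mul_of_notMem hG hx hy
    funext g
    have : conjChar hG (x * h) χ g = χ (conjBy hG x (h * g * h⁻¹)) :=
      congrArg χ (Subtype.ext (by simp [mul_assoc]))
    rw [this, map_mul, map_mul, map_inv, hχ.conj_apply]
  ext φ
  simp only [kleinOrbit, Set.mem_ofPred_eq, Set.mem_insert_iff, Set.mem_singleton_iff]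
  constructor
  · rintro (h | h | ⟨y, hy, h | h⟩)
    · exact Or.inl h
    · exact Or.inr (Or.inl h)
    · rw [key y hy] at h
      exact Or.inr (Or.inr (Or.inl h))
    · right; right; right
      rw [h]
      funext g
      rw [key y hy]
  · rintro (h | h | h | h)
    · exact Or.inl h
    · exact Or.inr (Or.inl h)
    · exact Or.inr (Or.inr ⟨x, hx, Or.inl h⟩)
    · exact Or.inr (Or.inr ⟨x, hx, Or.inr h⟩)

variable [Fintype G]

include hx in
theorem ncard_kleinOrbit_of_fixed {χ : G → ℂ} (hχ : IsIrrChar χ)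
    (h : (fun g => χ (conjBy hG x g)) = χ) (h1 : (fun g => conj (χ g)) ≠ χ) :
    (kleinOrbit hG χ).ncard = 2 := by
  have h2 : (fun g => conj (χ (conjBy hG x g))) = fun g => conj (χ g) :=
    funext fun g => congrArg conj (congrFun h g)
  rw [kleinOrbit_eq hG hx hχ, h, h2, Set.ncard_eq_two]
  refine ⟨χ, fun g => conj (χ g), h1.symm, ?_⟩
  ext φ
  simp only [Set.mem_insert_iff, Set.mem_singleton_iff]
  tauto

include hx in
theorem ncard_kleinOrbit_of_ne {χ : G → ℂ} (hχ : IsIrrChar χ)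
    (h : (fun g => χ (conjBy hG x g)) ≠ χ) (h1 : (fun g => conj (χ g)) ≠ χ)
    (h2 : (fun g => conj (χ g)) ≠ fun g => χ (conjBy hG x g)) :
    (kleinOrbit hG χ).ncard = 4 := by
  classical
  have hinj : ∀ φ θ : G → ℂ, (fun g => conj (φ g)) = (fun g => conj (θ g)) → φ = θ :=
    fun φ θ hh => funext fun g => (starRingEnd ℂ).injective (congrFun hh g)
  have h3 : χ ≠ fun g => conj (χ (conjBy hG x g)) := fun hh => h2 <| by
    funext g
    rw [show χ g = _ from congrFun hh g, Complex.conj_conj]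
  have h4 : (fun g => conj (χ g)) ≠ fun g => conj (χ (conjBy hG x g)) :=
    fun hh => h (hinj _ _ hh).symm
  have h5 : (fun g => χ (conjBy hG x g)) ≠ fun g => conj (χ (conjBy hG x g)) := fun hh => h1 <| by
    funext g
    obtain ⟨g, rfl⟩ := conjBy_surjective hG x g
    exact (congrFun hh g).symm
  rw [kleinOrbit_eq hG hx hχ, Set.ncard_insert_of_notMem, Set.ncard_insert_of_notMem,
    Set.ncard_pair h5]
  · simp only [Set.mem_insert_iff, Set.mem_singleton_iff, not_or]
    exact ⟨h2, h4⟩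
  · simp only [Set.mem_insert_iff, Set.mem_singleton_iff, not_or]
    exact ⟨h1.symm, h.symm, h3⟩

-- For IV and VII both indicators vanish, so the complex conjugate of `χ` differs from `χ` and from
-- `χ^x`. The orbit then has 2 elements if `χ^x = χ` and 4 otherwise, so its size can be traded for
-- invariance.
include hx in
theorem hasDysonType_iff {χ : G → ℂ} (t : DysonType) :
    HasDysonType hG χ t ↔ IsIrrChar χ ∧
      twistedIndicator (MonoidHom.id G) 1 χ = t.divA.sign ∧
      twistedIndicator (conjBy hG x) (squareIn hG x) χ = t.divD.sign ∧
      (t = .IV → (fun g => χ (conjBy hG x g)) = χ) ∧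
      (t = .VII → (fun g => χ (conjBy hG x g)) ≠ χ) := by
  rw [HasDysonType, hasCharType_iff, hasRealType_iff hG hx]
  constructor
  · rintro ⟨⟨hχ, ha⟩, ⟨-, hd⟩, h4, h7⟩
    obtain ⟨A, hA, hA'⟩ := hχ.twistedIndicator_eq_sign (α := MonoidHom.id G) (b := 1)
      (by simp) (by simp)
    obtain ⟨D, hD, hD'⟩ := hχ.twistedIndicator_eq_sign (conjBy_conjBy hG x) (conjBy_squareIn hG x)
    obtain rfl := DivType.sign_injective (ha.symm.trans hA)
    obtain rfl := DivType.sign_injective (hd.symm.trans hD)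
    refine ⟨hχ, ha, hd, ?_, ?_⟩
    · rintro rfl
      by_contra h
      have := ncard_kleinOrbit_of_ne hG hx hχ h (fun hh => hA'.mp hh rfl) (fun hh => hD'.mp hh rfl)
      have := h4 rfl
      omega
    · rintro rfl h
      have := ncard_kleinOrbit_of_fixed hG hx hχ h (fun hh => hA'.mp hh rfl)
      have := h7 rfl
      omega
  · rintro ⟨hχ, ha, hd, h4, h7⟩
    obtain ⟨A, hA, hA'⟩ := hχ.twistedIndicator_eq_sign (α := MonoidHom.id G) (b := 1)
      (by simp) (by simp)
    obtain ⟨D, hD, hD'⟩ := hχ.twistedIndicator_eq_sign (conjBy_conjBy hG x) (conjBy_squareIn hG x)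
    obtain rfl := DivType.sign_injective (ha.symm.trans hA)
    obtain rfl := DivType.sign_injective (hd.symm.trans hD)
    refine ⟨⟨hχ, ha⟩, ⟨hχ, hd⟩, ?_, ?_⟩
    · rintro rfl
      exact ncard_kleinOrbit_of_fixed hG hx hχ (h4 rfl) (fun hh => hA'.mp hh rfl)
    · rintro rfl
      exact ncard_kleinOrbit_of_ne hG hx hχ (h7 rfl) (fun hh => hA'.mp hh rfl)
        (fun hh => hD'.mp hh rfl)

include hx in
/-- The indicators of an irreducible character and their relation to invariance under
conjugation. -/
theorem IsIrrChar.exists_divTypes {χ : G → ℂ} (hχ : IsIrrChar χ) :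
    ∃ A D : DivType, twistedIndicator (MonoidHom.id G) 1 χ = A.sign ∧
      twistedIndicator (conjBy hG x) (squareIn hG x) χ = D.sign ∧
      (A ≠ .complex → D ≠ .complex → (fun g => χ (conjBy hG x g)) = χ) ∧
      ((fun g => χ (conjBy hG x g)) = χ → (A ≠ .complex ↔ D ≠ .complex)) := by
  obtain ⟨A, hA, hA'⟩ := hχ.twistedIndicator_eq_sign (α := MonoidHom.id G) (b := 1)
    (by simp) (by simp)
  obtain ⟨D, hD, hD'⟩ := hχ.twistedIndicator_eq_sign (conjBy_conjBy hG x) (conjBy_squareIn hG x)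
  refine ⟨A, D, hA, hD, fun h1 h2 => ?_, fun h => ?_⟩
  · exact (hD'.mpr h2).symm.trans (hA'.mpr h1)
  · rw [← hA', ← hD', h]
    rfl

end Dyson

theorem DivType.sign_eq_iff (F F' : DivType) : F.sign = F'.sign ↔ F = F' :=
  DivType.sign_injective.eq_iff

theorem mainTheorem6 {Γ : Type*} [Group Γ] [Finite Γ] (G : Subgroup Γ) (hG : G.index = 2) :
    (2 * (dysonCount hG .I : ℚ) + 1 / 2 * (dysonCount hG .III : ℚ)
        + 1 / 2 * (dysonCount hG .V : ℚ) = (charCount Γ .real : ℚ)) ∧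
    (2 * (dysonCount hG .II : ℚ) + 2 * (dysonCount hG .IV : ℚ)
        + 1 / 2 * (dysonCount hG .VII : ℚ) + 2 * (dysonCount hG .IX : ℚ)
        = (charCount Γ .complex : ℚ)) ∧
    (1 / 2 * (dysonCount hG .VI : ℚ) + 2 * (dysonCount hG .VIII : ℚ)
        + 1 / 2 * (dysonCount hG .X : ℚ) = (charCount Γ .quaternion : ℚ)) := by
  obtain ⟨x, hx⟩ : ∃ x, x ∉ G := by
    by_contra! hc
    have : G = ⊤ := by rw [eq_top_iff]; exact fun y _ => hc y
    rw [this, Subgroup.index_top] at hG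
    omega
  have := Fintype.ofFinite Γ
  have := Fintype.ofFinite G
  let S : DysonType → Set (G → ℂ) := fun t => {χ | HasDysonType hG χ t}
  have hS : ∀ t, dysonCount hG t = (S t).ncard := fun t => rfl
  have hmem : ∀ t χ, χ ∈ S t ↔ _ := fun t χ => hasDysonType_iff hG hx t
  have hfin : ∀ t, (S t).Finite := fun t =>
    finite_setOf_isIrrChar.subset fun χ hχ => ((hmem t χ).mp hχ).1
  have hdisj : ∀ t t', t.divA ≠ t'.divA ∨ t.divD ≠ t'.divD → Disjoint (S t) (S t') := by
    intro t t' h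
    rw [Set.disjoint_left]
    intro χ h1 h2
    rw [hmem] at h1 h2
    rcases h with h | h
    · exact h (DivType.sign_injective (h1.2.1.symm.trans h2.2.1))
    · exact h (DivType.sign_injective (h1.2.2.1.symm.trans h2.2.2.1))
  -- Identifies a set counted in `charCount_eq` with a union of Dyson classes, reducing the
  -- comparison to the types `A`, `D` and the two constraints linking them to invariance.
  have hB : ∀ (P : (G → ℂ) → Prop) (c : ℂ) (T : Set (G → ℂ)),
      (∀ χ, IsIrrChar χ → ∀ A D : DivType, twistedIndicator (MonoidHom.id G) 1 χ = A.sign →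
        twistedIndicator (conjBy hG x) (squareIn hG x) χ = D.sign →
        (A ≠ .complex → D ≠ .complex → (fun g => χ (conjBy hG x g)) = χ) →
        ((fun g => χ (conjBy hG x g)) = χ → (A ≠ .complex ↔ D ≠ .complex)) →
        (P χ ∧ A.sign + D.sign = c ↔ χ ∈ T)) → (∀ χ ∈ T, IsIrrChar χ) →
      {χ : G → ℂ | IsIrrChar χ ∧ P χ ∧ twistedIndicator (MonoidHom.id G) 1 χ +
        twistedIndicator (conjBy hG x) (squareIn hG x) χ = c} = T := by
    intro P c T h hT
    ext χ
    constructor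
    · rintro ⟨hχ, h1, h2⟩
      obtain ⟨A, D, hA, hD, h3, h4⟩ := hχ.exists_divTypes hG hx
      rw [hA, hD] at h2
      exact (h χ hχ A D hA hD h3 h4).mp ⟨h1, h2⟩
    · intro hχT
      have hχ := hT χ hχT
      obtain ⟨A, D, hA, hD, h3, h4⟩ := hχ.exists_divTypes hG hx
      have := (h χ hχ A D hA hD h3 h4).mpr hχT
      refine ⟨hχ, this.1, ?_⟩
      rw [hA, hD]
      exact this.2
  have hirr : ∀ t, ∀ χ ∈ S t, IsIrrChar χ := fun t χ h => ((hmem t χ).mp h).1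
  refine ⟨?_, ?_, ?_⟩
  · rw [charCount_eq hG hx, hB _ _ (S .I) ?_ (hirr _), hB _ _ (S .III ∪ S .V) ?_ ?_,
      Set.ncard_union_eq (hdisj _ _ (by simp [DysonType.divA])) (hfin _) (hfin _), hS, hS, hS]
    · push_cast
      ring
    · intro χ hχ A D hA hD h3 h4
      rw [Set.mem_union, hmem, hmem, hA, hD]
      simp only [DivType.sign_eq_iff, hχ, ne_eq] at h3 h4 ⊢
      revert h3 h4
      -- Only the truth value of invariance matters, which leaves a check over the nine pairs `(A,
      -- D)`; `h3` and `h4` rule out the impossible combinations.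
      generalize ((fun g => χ (conjBy hG x g)) = χ) = I
      clear * -
      cases A <;> cases D <;> simp [DivType.sign, DysonType.divA, DysonType.divD] <;> norm_num
    · rintro χ (h | h) <;> exact hirr _ _ h
    · intro χ hχ A D hA hD h3 h4
      rw [hmem, hA, hD]
      simp only [DivType.sign_eq_iff, hχ, ne_eq] at h3 h4 ⊢
      revert h3 h4
      generalize ((fun g => χ (conjBy hG x g)) = χ) = I
      clear * -
      cases A <;> cases D <;> simp [DivType.sign, DysonType.divA, DysonType.divD] <;> norm_num
  · rw [charCount_eq hG hx, hB _ _ (S .II ∪ S .IV ∪ S .IX) ?_ ?_, hB _ _ (S .VII) ?_ (hirr _),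
      Set.ncard_union_eq _ ((hfin _).union (hfin _)) (hfin _),
      Set.ncard_union_eq (hdisj _ _ (by simp [DysonType.divA])) (hfin _) (hfin _), hS, hS, hS, hS]
    · push_cast
      ring
    · rw [Set.disjoint_union_left]
      exact ⟨hdisj _ _ (by simp [DysonType.divA]), hdisj _ _ (by simp [DysonType.divA])⟩
    · intro χ hχ A D hA hD h3 h4
      rw [hmem, hA, hD]
      simp only [DivType.sign_eq_iff, hχ, ne_eq] at h3 h4 ⊢
      revert h3 h4
      generalize ((fun g => χ (conjBy hG x g)) = χ) = I
      clear * -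
      cases A <;> cases D <;> simp [DivType.sign, DysonType.divA, DysonType.divD]
    · intro χ hχ A D hA hD h3 h4
      rw [Set.mem_union, Set.mem_union, hmem, hmem, hmem, hA, hD]
      simp only [DivType.sign_eq_iff, hχ, ne_eq] at h3 h4 ⊢
      revert h3 h4
      generalize ((fun g => χ (conjBy hG x g)) = χ) = I
      clear * -
      cases A <;> cases D <;> simp [DivType.sign, DysonType.divA, DysonType.divD]
    · rintro χ ((h | h) | h) <;> exact hirr _ _ h
  · rw [charCount_eq hG hx, hB _ _ (S .VIII) ?_ (hirr _), hB _ _ (S .VI ∪ S .X) ?_ ?_,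
      Set.ncard_union_eq (hdisj _ _ (by simp [DysonType.divA])) (hfin _) (hfin _), hS, hS, hS]
    · push_cast
      ring
    · intro χ hχ A D hA hD h3 h4
      rw [Set.mem_union, hmem, hmem, hA, hD]
      simp only [DivType.sign_eq_iff, hχ, ne_eq] at h3 h4 ⊢
      revert h3 h4
      generalize ((fun g => χ (conjBy hG x g)) = χ) = I
      clear * -
      cases A <;> cases D <;> simp [DivType.sign, DysonType.divA, DysonType.divD] <;> norm_num
    · rintro χ (h | h) <;> exact hirr _ _ h
    · intro χ hχ A D hA hD h3 h4
      rw [hmem, hA, hD]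
      simp only [DivType.sign_eq_iff, hχ, ne_eq] at h3 h4 ⊢
      revert h3 h4
      generalize ((fun g => χ (conjBy hG x g)) = χ) = I
      clear * -
      cases A <;> cases D <;> simp [DivType.sign, DysonType.divA, DysonType.divD] <;> norm_num
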